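/- Let $k$ be an algebraically closed field and let $X$ be a projective variety over $k$ (integral, proper over $k$, with an ample line bundle) such that $\operatorname{Pic}(X)$ is free of finite rank $r$ and coincides with the divisor class group, i.e. the canonical homomorphism $\operatorname{Pic}(X)\to\operatorname{Cl}(X)$ is an isomorphism. Let $L_1,\dots,L_r$ be (Cartier divisors of) line bundles whose classes form a basis of $\operatorname{Pic}(X)$, and let $$\operatorname{Cox}(X)=\bigoplus_{(m_1,\dots,m_r)\in\mathbb Z^r}H^0(X,m_1L_1+\dots+m_rL_r),$$ with the multiplication induced by the product of rational functions. This ring is graded by $\operatorname{Pic}(X)$. Assume that $\operatorname{Cox}(X)$ is a finitely generated $k$-algebra. The torus $T_X=\operatorname{Hom}(\operatorname{Pic}(X),k^*)=\operatorname{Spec}k[\operatorname{Pic}(X)]$ acts on $\overline X=\operatorname{Spec}(\operatorname{Cox}(X))$ through the grading: $t\cdot s=t(D)\,s$ for $s\in\operatorname{Cox}(X)_D$. For an ample line bundle $A$ on $X$, let $J_X$ be the radical of the ideal of $\operatorname{Cox}(X)$ generated by $\bigoplus_{n\ge 1}\operatorname{Cox}(X)_{nA}$, and let $\hat X=\operatorname{Spec}(\operatorname{Cox}(X))\setminus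 V(J_X)$. Then the action of $T_X$ on $\overline X$ restricts to an action on $\hat X$, and $X$ is a good geometric quotient of $\hat X$ by $T_X$. That is, there is a morphism $\pi:\hat X\to X$ over $k$ that is $T_X$-invariant, affine and surjective, such that 1. for every open $U\subseteq X$, pullback by $\pi$ identifies $\mathcal O_X(U)$ with the ring of $T_X$-invariant functions on $\pi^{-1}(U)$; 2. $\pi$ maps closed $T_X$-invariant subsets to closed subsets, and disjoint closed $T_X$-invariant subsets to disjoint subsets; 3. the fibres of $\pi$ are the $T_X$-orbits, i.e. the morphism $T_X\times\hat X\to\hat X\times_X\hat X$, $(t,x)\mapsto(t\cdot x,x)$, is surjective. -/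

import Mathlib

open AlgebraicGeometry CategoryTheory TopologicalSpace Opposite
open MonoidalCategory CartesianMonoidalCategory
open scoped DirectSum TensorProduct MonObj

universe u

noncomputable section

namespace CoxQuotient

section CartierDivisors

variable (X : Scheme.{u}) [IsIntegral X]

/-- The image of `𝒪_{X,x}ˣ` in the multiplicative group `K(X)ˣ` of the function field. -/
def stalkUnits (x : X) : Subgroup (X.functionField)ˣ :=
  (Units.map (algebraMap (X.presheaf.stalk x) X.functionField).toMonoidHom).range

/-- The group `K(X)ˣ / 𝒪_{X,x}ˣ`, written additively. -/
def CartierGerm (x : X) : Type u := Additive ((X.functionField)ˣ ⧸ stalkUnits X x)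

instance (x : X) : AddCommGroup (CartierGerm X x) :=
  inferInstanceAs (AddCommGroup (Additive ((X.functionField)ˣ ⧸ stalkUnits X x)))

/-- The class of a nonzero rational function in `K(X)ˣ / 𝒪_{X,x}ˣ`. -/
def toGerm (x : X) : Additive (X.functionField)ˣ →+ CartierGerm X x :=
  MonoidHom.toAdditive (QuotientGroup.mk' (stalkUnits X x))

/-- The global sections of the sheaf `K(X)ˣ / 𝒪_Xˣ`: families of germs that are locally given by
one rational function. -/
def cartierSubgroup : AddSubgroup (∀ x : X, CartierGerm X x) where
  carrier := {D | ∀ x : X, ∃ U : X.Opens, x ∈ U ∧ ∃ g : Additive (X.functionField)ˣ,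
    ∀ y ∈ U, D y = toGerm X y g}
  zero_mem' := fun x => ⟨⊤, trivial, 0, fun y _ => (map_zero (toGerm X y)).symm⟩
  add_mem' := by
    intro D E hD hE x
    obtain ⟨U, hU, g, hg⟩ := hD x
    obtain ⟨V, hV, h, hh⟩ := hE x
    refine ⟨U ⊓ V, ⟨hU, hV⟩, g + h, fun y hy => ?_⟩
    rw [Pi.add_apply, hg y hy.1, hh y hy.2, map_add]
  neg_mem' := by
    intro D hD x
    obtain ⟨U, hU, g, hg⟩ := hD x
    refine ⟨U, hU, -g, fun y hy => ?_⟩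
    rw [Pi.neg_apply, hg y hy, map_neg]

/-- Cartier divisors on an integral scheme. -/
def CartierDivisor : Type u := cartierSubgroup X

instance : AddCommGroup (CartierDivisor X) := inferInstanceAs (AddCommGroup (cartierSubgroup X))

variable {X}

/-- The germ of a Cartier divisor at a point. -/
def germ (x : X) : CartierDivisor X →+ CartierGerm X x :=
  (Pi.evalAddMonoidHom _ x).comp (cartierSubgroup X).subtype

/-- `g` is a local equation of the Cartier divisor `D` at the point `x`. -/
def IsLocalEquation (D : CartierDivisor X) (x : X) (g : (X.functionField)ˣ) : Prop :=
  germ x D = toGerm X x (Additive.ofMul g)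

lemma exists_isLocalEquation_nhds (D : CartierDivisor X) (x : X) :
    ∃ U : X.Opens, x ∈ U ∧ ∃ g, ∀ y ∈ U, IsLocalEquation D y g := by
  obtain ⟨U, hU, g, hg⟩ := D.2 x
  exact ⟨U, hU, g.toMul, hg⟩

lemma exists_isLocalEquation (D : CartierDivisor X) (x : X) : ∃ g, IsLocalEquation D x g := by
  obtain ⟨U, hU, g, hg⟩ := exists_isLocalEquation_nhds D x
  exact ⟨g, hg x hU⟩

lemma IsLocalEquation.add {D E : CartierDivisor X} {x : X} {g h : (X.functionField)ˣ}
    (hg : IsLocalEquation D x g) (hh : IsLocalEquation E x h) :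
    IsLocalEquation (D + E) x (g * h) := by
  unfold IsLocalEquation at *
  rw [map_add, hg, hh, ofMul_mul, map_add]

lemma isLocalEquation_zero_one (x : X) : IsLocalEquation (0 : CartierDivisor X) x 1 := by
  unfold IsLocalEquation
  rw [map_zero, ofMul_one, map_zero]

lemma IsLocalEquation.exists_eq {D : CartierDivisor X} {x : X} {g h : (X.functionField)ˣ}
    (hg : IsLocalEquation D x g) (hh : IsLocalEquation D x h) :
    ∃ v : (X.presheaf.stalk x)ˣ,
      (h : X.functionField) = g * algebraMap (X.presheaf.stalk x) X.functionField v := by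
  have h1 : (QuotientGroup.mk g : (X.functionField)ˣ ⧸ stalkUnits X x) = QuotientGroup.mk h :=
    Additive.ofMul.injective (hg.symm.trans hh)
  obtain ⟨v, hv⟩ := QuotientGroup.eq.mp h1
  refine ⟨v, ?_⟩
  have h2 : h = g * (g⁻¹ * h) := by group
  rw [h2, ← hv]
  rfl

variable (X) in
/-- The principal Cartier divisor `div(g)` of a nonzero rational function `g`. -/
def principalDivisor : Additive (X.functionField)ˣ →+ CartierDivisor X :=
  (AddMonoidHom.pi (toGerm X)).codRestrict (cartierSubgroup X)
    fun g _ => ⟨⊤, trivial, g, fun _ _ => rfl⟩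

variable (X) in
/-- The Picard group of an integral scheme: Cartier divisors modulo linear equivalence.
The class of `D` is the class of the line bundle `𝒪_X(D)`. -/
def Pic : Type u := CartierDivisor X ⧸ (principalDivisor X).range

instance : AddCommGroup (Pic X) :=
  inferInstanceAs (AddCommGroup (CartierDivisor X ⧸ (principalDivisor X).range))

/-- The class of a Cartier divisor in the Picard group. -/
def toPic : CartierDivisor X →+ Pic X := QuotientAddGroup.mk' (principalDivisor X).range

end CartierDivisors

section WeilDivisors

variable (X : Scheme.{u}) [IsIntegral X] [IsLocallyNoetherian X]

/-- Locally finite integral combinations of points of codimension one. -/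
def weilSubgroup : AddSubgroup (AlgebraicCycle X ℤ) where
  carrier := {W | ∀ x : X, W x ≠ 0 → Order.coheight x = 1}
  zero_mem' := fun x hx => (hx rfl).elim
  add_mem' := by
    intro V W hV hW x hx
    by_cases h : V x = 0
    · refine hW x fun h' => hx ?_
      change V x + W x = 0
      rw [h, h', add_zero]
    · exact hV x h
  neg_mem' := by
    intro V hV x hx
    refine hV x fun h => hx ?_
    change - V x = 0
    rw [h, neg_zero]

/-- Weil divisors. -/
def WeilDivisor : Type u := weilSubgroup X

instance : AddCommGroup (WeilDivisor X) := inferInstanceAs (AddCommGroup (weilSubgroup X))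

/-- The order along (the closure of) `z` as a homomorphism on `K(X)ˣ`. -/
def ordUnits (z : X) : (X.functionField)ˣ →* Multiplicative ℤ where
  toFun g := Multiplicative.ofAdd (Scheme.ord (g : X.functionField) z)
  map_one' := by
    have h := Scheme.ord_mul (x := z) (one_ne_zero (α := X.functionField))
      (one_ne_zero (α := X.functionField))
    rw [mul_one] at h
    rw [Units.val_one, ← ofAdd_zero]
    congr 1
    omega
  map_mul' g h := by
    rw [Units.val_mul, Scheme.ord_mul g.ne_zero h.ne_zero, ofAdd_add]

lemma stalkUnits_le_ker_ordUnits (z : X) : stalkUnits X z ≤ (ordUnits X z).ker := by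
  rintro _ ⟨v, rfl⟩
  rw [MonoidHom.mem_ker]
  change Multiplicative.ofAdd (Scheme.ord (algebraMap (X.presheaf.stalk z) X.functionField v) z) =
    1
  rw [← ofAdd_zero]
  congr 1
  by_cases hz : Order.coheight z = 1
  · rw [Scheme.ord_eq_iff hz
      ((IsUnit.map (algebraMap (X.presheaf.stalk z) X.functionField) v.isUnit).ne_zero)]
    have : Ring.KrullDimLE 1 (X.presheaf.stalk z) := krullDimLE_of_coheight_le hz.le
    exact Ring.ordFrac_of_isUnit v.isUnit
  · exact Scheme.ord_eq_zero_of_coheight_neq_one hz _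

/-- The order along `z` of a germ of Cartier divisor at `z`, i.e. of any of its local equations. -/
def ordGerm (z : X) : CartierGerm X z →+ ℤ :=
  MonoidHom.toAdditiveLeft (QuotientGroup.lift _ (ordUnits X z) (stalkUnits_le_ker_ordUnits X z))

lemma ordGerm_toGerm (z : X) (g : Additive (X.functionField)ˣ) :
    ordGerm X z (toGerm X z g) = Scheme.ord (g.toMul : X.functionField) z := rfl

lemma ordGerm_of_coheight_ne_one {z : X} (hz : Order.coheight z ≠ 1) (c : CartierGerm X z) :
    ordGerm X z c = 0 := by
  obtain ⟨g, rfl⟩ : ∃ g, toGerm X z g = c := by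
    obtain ⟨g, hg⟩ := QuotientGroup.mk_surjective (Additive.toMul c)
    exact ⟨Additive.ofMul g, congrArg Additive.ofMul hg⟩
  rw [ordGerm_toGerm, Scheme.ord_eq_zero_of_coheight_neq_one hz]

/-- A nonzero rational function has nonzero order at only finitely many points of any affine
open set. -/
lemma ord_locallyFinite (g : (X.functionField)ˣ) (x : X) :
    ∃ t ∈ nhds x, (t ∩ Function.support (Scheme.ord (g : X.functionField))).Finite := by
  obtain ⟨V, hV, f, hne, hf, hu⟩ := exists_isUnit_germ_eq X (g : X.functionField) g.ne_zero
  obtain ⟨_, ⟨A, hA, rfl⟩, hxA, -⟩ :=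
    X.isBasis_affineOpens.exists_subset_of_mem_open (Set.mem_univ x) isOpen_univ
  refine ⟨A, A.isOpen.mem_nhds hxA, ?_⟩
  have hA' : IsNoetherianRing Γ(X, A) := IsLocallyNoetherian.component_noetherian ⟨A, hA⟩
  have hN : NoetherianSpace (A : Set X) := noetherianSpace_of_isAffineOpen A hA
  have hη : genericPoint X ∈ V :=
    ((genericPoint_spec X).mem_open_set_iff V.isOpen).mpr (by simpa using hne)
  obtain ⟨S, hSfin, hScl, hSirr, hZ⟩ :=
    NoetherianSpace.exists_finite_set_isClosed_irreducible
      (s := (Subtype.val ⁻¹' (V : Set X) : Set (A : Set X))ᶜ)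
      (V.isOpen.preimage continuous_subtype_val).isClosed_compl
  have hSZ : ∀ C ∈ S, C ⊆ (Subtype.val ⁻¹' (V : Set X) : Set (A : Set X))ᶜ := fun C hC => by
    rw [hZ]
    exact Set.subset_sUnion_of_mem hC
  have hq : QuasiSober (A : Set X) := A.isOpen.isOpenEmbedding_subtypeVal.quasiSober
  have hgen : ∀ C : S, ∃ c : (A : Set X), IsGenericPoint c C.1 := fun C =>
    QuasiSober.sober (hSirr C.1 C.2) (hScl C.1 C.2)
  choose c hc using hgen
  have : Finite S := hSfin
  refine (Set.finite_range fun C : S => (c C : X)).subset ?_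
  rintro z ⟨hzA, hz⟩
  have hzV : z ∉ V := fun hzV => hz (by
    rw [← hf]
    exact Scheme.ord_of_isUnit hu hzV)
  have hz1 : Order.coheight z = 1 := by
    by_contra h
    exact hz (Scheme.ord_eq_zero_of_coheight_neq_one h _)
  have hzZ : (⟨z, hzA⟩ : (A : Set X)) ∈ (Subtype.val ⁻¹' (V : Set X) : Set (A : Set X))ᶜ := hzV
  rw [hZ] at hzZ
  obtain ⟨C, hCS, hzC⟩ := hzZ
  refine ⟨⟨C, hCS⟩, ?_⟩
  have hcZ : (c ⟨C, hCS⟩ : X) ∉ V := hSZ C hCS (hc ⟨C, hCS⟩).mem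
  have hspec : (c ⟨C, hCS⟩ : X) ⤳ z :=
    ((hc ⟨C, hCS⟩).specializes hzC).map continuous_subtype_val
  by_contra hne'
  have hlt : z < (c ⟨C, hCS⟩ : X) := by
    refine lt_of_le_not_ge hspec fun h => hne' ?_
    exact (Specializes.antisymm hspec h).eq
  have hlt' : (c ⟨C, hCS⟩ : X) < genericPoint X := by
    refine lt_of_le_not_ge (genericPoint_specializes _) fun h => hcZ ?_
    exact Specializes.mem_open h V.isOpen hη
  have h1 := Order.coheight_add_one_le hlt
  have h2 := Order.coheight_add_one_le hlt'
  rw [hz1] at h1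
  have h3 : (1 : ℕ∞) + 1 ≤ 1 :=
    (add_le_add_left (le_trans le_add_self h2) 1).trans h1
  exact absurd h3 (by decide)

/-- The Weil divisor of a Cartier divisor. -/
def cartierToWeil : CartierDivisor X →+ WeilDivisor X where
  toFun D := ⟨⟨fun z => ordGerm X z (germ z D), Set.subset_univ _, fun x _ => by
      obtain ⟨U, hU, g, hg⟩ := exists_isLocalEquation_nhds D x
      obtain ⟨t, ht, hfin⟩ := ord_locallyFinite X g x
      refine ⟨U ∩ t, Filter.inter_mem (U.isOpen.mem_nhds hU) ht, hfin.subset ?_⟩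
      rintro y ⟨⟨hyU, hyt⟩, hy⟩
      refine ⟨hyt, ?_⟩
      rw [Function.mem_support] at hy ⊢
      rwa [hg y hyU, ordGerm_toGerm] at hy⟩,
    fun z hz => by
      by_contra h
      exact hz (ordGerm_of_coheight_ne_one X h _)⟩
  map_zero' := Subtype.ext <| Function.locallyFinsuppWithin.ext fun z => by
    change ordGerm X z (germ z 0) = 0
    rw [map_zero, map_zero]
  map_add' D E := Subtype.ext <| Function.locallyFinsuppWithin.ext fun z => by
    change ordGerm X z (germ z (D + E)) = ordGerm X z (germ z D) + ordGerm X z (germ z E)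
    rw [map_add, map_add]

/-- The divisor class group: Weil divisors modulo divisors of rational functions. -/
def ClassGroup : Type u :=
  WeilDivisor X ⧸ ((cartierToWeil X).comp (principalDivisor X)).range

instance : AddCommGroup (ClassGroup X) :=
  inferInstanceAs (AddCommGroup (WeilDivisor X ⧸ ((cartierToWeil X).comp (principalDivisor X)).range))

/-- The canonical homomorphism `Pic(X) → Cl(X)`. -/
def picToClassGroup : Pic X →+ ClassGroup X :=
  QuotientAddGroup.map _ _ (cartierToWeil X) (by
    rintro _ ⟨g, rfl⟩
    exact ⟨g, rfl⟩)

/-- A scheme locally of finite type over a field is locally Noetherian. -/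
lemma isLocallyNoetherian_of_locallyOfFiniteType (k : Type u) [Field k] (X : Scheme.{u})
    [X.Over (Spec (.of k))] [LocallyOfFiniteType (X ↘ Spec (.of k))] : IsLocallyNoetherian X :=
  LocallyOfFiniteType.isLocallyNoetherian (X ↘ Spec (.of k))

/-- `Pic(X)` coincides with `Cl(X)`: the canonical homomorphism `Pic(X) → Cl(X)` is bijective. -/
def PicEqCl (k : Type u) [Field k] (X : Scheme.{u}) [IsIntegral X] [X.Over (Spec (.of k))]
    [LocallyOfFiniteType (X ↘ Spec (.of k))] : Prop :=
  haveI := isLocallyNoetherian_of_locallyOfFiniteType k X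
  Function.Bijective (picToClassGroup X)

end WeilDivisors

section CoxRing

variable (k : Type u) [Field k] (X : Scheme.{u}) [IsIntegral X] [X.Over (Spec (.of k))]

/-- The constants `k → Γ(X, 𝒪_X)` of a scheme over `k`. -/
def constants : k →+* Γ(X, ⊤) :=
  ((Scheme.ΓSpecIso (.of k)).inv ≫ (X ↘ Spec (.of k)).appTop).hom

/-- The function field of an integral `k`-scheme is a `k`-algebra. -/
instance functionFieldAlgebra : Algebra k X.functionField :=
  ((X.presheaf.germ ⊤ (genericPoint X) (Opens.mem_top _)).hom.comp (constants k X)).toAlgebra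

variable {X}

/-- `H⁰(X, D) = H⁰(X, 𝒪_X(D))`: the rational functions `f` with `div(f) + D ≥ 0`, i.e. such that
`f * g` is regular at `x` for each local equation `g` of `D` at each point `x`. -/
def H0 (D : CartierDivisor X) : Submodule k X.functionField where
  carrier := {f | ∀ (x : X) (g : (X.functionField)ˣ), IsLocalEquation D x g →
    ∃ a : X.presheaf.stalk x, algebraMap (X.presheaf.stalk x) X.functionField a = f * g}
  zero_mem' := fun x g _ => ⟨0, by rw [map_zero, zero_mul]⟩
  add_mem' := by
    intro f f' hf hf' x g hg
    obtain ⟨a, ha⟩ := hf x g hg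
    obtain ⟨a', ha'⟩ := hf' x g hg
    exact ⟨a + a', by rw [map_add, ha, ha', add_mul]⟩
  smul_mem' := by
    intro c f hf x g hg
    obtain ⟨a, ha⟩ := hf x g hg
    have : Nonempty (⊤ : X.Opens) := ⟨⟨x, Opens.mem_top x⟩⟩
    refine ⟨X.presheaf.germ ⊤ x (Opens.mem_top x) (constants k X c) * a, ?_⟩
    rw [map_mul, ha, Scheme.algebraMap_germ_eq_germToFunctionField, Algebra.smul_def, mul_assoc]
    rfl

lemma one_mem_H0 : (1 : X.functionField) ∈ H0 k (0 : CartierDivisor X) := by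
  intro x g hg
  obtain ⟨v, hv⟩ := (isLocalEquation_zero_one x).exists_eq hg
  exact ⟨v, by rw [hv, Units.val_one, one_mul, one_mul]⟩

lemma mul_mem_H0 {D E : CartierDivisor X} {f f' : X.functionField} (hf : f ∈ H0 k D)
    (hf' : f' ∈ H0 k E) : f * f' ∈ H0 k (D + E) := by
  intro x g hg
  obtain ⟨d, hd⟩ := exists_isLocalEquation D x
  obtain ⟨e, he⟩ := exists_isLocalEquation E x
  obtain ⟨v, hv⟩ := (hd.add he).exists_eq hg
  obtain ⟨a, ha⟩ := hf x d hd
  obtain ⟨b, hb⟩ := hf' x e he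
  refine ⟨a * b * v, ?_⟩
  rw [map_mul, map_mul, ha, hb, hv, Units.val_mul]
  ring

/-- The section `f` of `𝒪_X(D)` does not vanish at `x`: it generates `𝒪_X(D)` near `x`, i.e.
`div(f) + D = 0` near `x`. -/
def IsNonvanishingAt (D : CartierDivisor X) (f : X.functionField) (x : X) : Prop :=
  ∃ h : f ≠ 0, IsLocalEquation D x (Units.mk0 f h)⁻¹

/-- `D` is ample: `X` is quasi-compact and each point has an affine neighbourhood of the form
`X_s` for a section `s` of a positive multiple of `D`. -/
structure IsAmple (D : CartierDivisor X) : Prop where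
  compact : CompactSpace X
  exists_section : ∀ x : X, ∃ n : ℕ, 0 < n ∧ ∃ s ∈ H0 k (n • D), ∃ U : X.Opens,
    IsAffineOpen U ∧ x ∈ U ∧ ∀ y : X, y ∈ U ↔ IsNonvanishingAt (n • D) s y

variable {r : ℕ} (L : Fin r → CartierDivisor X)

/-- The divisor `m₁L₁ + ⋯ + m_rL_r`. -/
def multiDivisor : (Fin r → ℤ) →+ CartierDivisor X where
  toFun m := ∑ i, m i • L i
  map_zero' := by simp
  map_add' m n := by simp [add_smul, Finset.sum_add_distrib]

/-- The graded piece `H⁰(X, m₁L₁ + ⋯ + m_rL_r)`. -/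
abbrev coxPiece (m : Fin r → ℤ) : Submodule k X.functionField := H0 k (multiDivisor L m)

instance : SetLike.GradedMonoid (coxPiece k L) where
  one_mem := by
    unfold coxPiece
    rw [map_zero]
    exact one_mem_H0 k
  mul_mem m n f f' hf hf' := by
    unfold coxPiece at *
    rw [map_add]
    exact mul_mem_H0 k hf hf'

/-- The Cox ring `Cox(X, L) = ⨁ₘ H⁰(X, m₁L₁ + ⋯ + m_rL_r)`, with the multiplication induced by the
product of rational functions. -/
def Cox : Type u := ⨁ m : Fin r → ℤ, coxPiece k L m

instance : CommRing (Cox k L) := inferInstanceAs (CommRing (⨁ m : Fin r → ℤ, coxPiece k L m))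

instance : Algebra k (Cox k L) := inferInstanceAs (Algebra k (⨁ m : Fin r → ℤ, coxPiece k L m))

/-- The homogeneous element of degree `m` of the Cox ring given by a section. -/
def coxOf (m : Fin r → ℤ) : coxPiece k L m →ₗ[k] Cox k L :=
  DirectSum.lof k (Fin r → ℤ) (fun m => coxPiece k L m) m

lemma cox_induction {P : Cox k L → Prop} (c : Cox k L) (zero : P 0)
    (of : ∀ m s, P (coxOf k L m s)) (add : ∀ x y, P x → P y → P (x + y)) : P c :=
  DirectSum.induction_on (motive := P) c zero of add

/-- The ideal `B_{X,D}` generated by the homogeneous elements whose degree in `Pic(X)` is a positive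
multiple of the class of `D`, i.e. by the positive part of `R_D = ⨁_{n ≥ 0} Cox(X)_{nD}`. -/
def sectionIdeal (D : CartierDivisor X) : Ideal (Cox k L) :=
  Ideal.span {z | ∃ n : ℕ, 0 < n ∧ ∃ m : Fin r → ℤ,
    toPic (multiDivisor L m) = n • toPic D ∧ ∃ s : coxPiece k L m, z = coxOf k L m s}

/-- The ideal `J_{X,D}`, the radical of `B_{X,D}`. For ample `D` this is the irrelevant ideal. -/
def irrelevantIdeal (D : CartierDivisor X) : Ideal (Cox k L) := (sectionIdeal k L D).radical

/-- The total coordinate space `X̄ = Spec(Cox(X))`. -/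
abbrev totalSpace : Scheme.{u} := Spec (.of (Cox k L))

/-- The open subset `X̂ = Spec(Cox(X)) \ V(J_{X,D})`. -/
def semistable (D : CartierDivisor X) : (totalSpace k L).Opens :=
  ⟨(PrimeSpectrum.zeroLocus (irrelevantIdeal k L D : Set (Cox k L)))ᶜ,
    (PrimeSpectrum.isClosed_zeroLocus _).isOpen_compl⟩

end CoxRing

section SpecAction

open Functor.LaxMonoidal (μ_natural_left_assoc μ_natural_right_assoc)
open scoped Obj MonoidalLeftAction

/-- A lax monoidal functor maps an action of a monoid object to an action of its image. -/
abbrev modObjObj {C D : Type*} [Category C] [Category D] [MonoidalCategory C] [MonoidalCategory D]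
    (F : C ⥤ D) [F.LaxMonoidal] (M X : C) [MonObj M] [ModObj M X] :
    ModObj (F.obj M) (F.obj X) where
  smul := Functor.LaxMonoidal.μ F M X ≫ F.map γ[M, X]
  one_smul := by
    change (Functor.LaxMonoidal.ε F ≫ F.map η[M]) ▷ F.obj X ≫ _ = (λ_ _).hom
    simp_rw [comp_whiskerRight, Category.assoc, μ_natural_left_assoc]
    rw [← F.map_comp, ModObj.one_smul_self]
    simp
  mul_smul := by
    change (Functor.LaxMonoidal.μ F M M ≫ F.map μ[M]) ▷ F.obj X ≫ _ =
      (α_ _ _ _).hom ≫ F.obj M ◁ _ ≫ _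
    simp_rw [comp_whiskerRight, Category.assoc, μ_natural_left_assoc,
      MonoidalCategory.whiskerLeft_comp, Category.assoc, μ_natural_right_assoc]
    slice_lhs 3 4 => rw [← F.map_comp, ModObj.mul_smul_self]
    simp

variable (R A C : CommRingCat.{u}) [Bialgebra R A] [Algebra R C] (ρ : C →ₐ[R] A ⊗[R] C)
  (h1 : ∀ c, Algebra.TensorProduct.lid R C
    (Algebra.TensorProduct.map (Bialgebra.counitAlgHom R A) (AlgHom.id R C) (ρ c)) = c)
  (h2 : ∀ c, Algebra.TensorProduct.assoc R R R A A C
      (Algebra.TensorProduct.map (Bialgebra.comulAlgHom R A) (AlgHom.id R C) (ρ c)) =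
    Algebra.TensorProduct.map (AlgHom.id R A) ρ (ρ c))

/-- A counital and coassociative coaction of a bialgebra on an algebra, as an action in the opposite
category of commutative algebras. -/
@[reducible]
def coactObj :
    ModObj (C := (CommAlgCat R)ᵒᵖ) (op (CommAlgCat.of R A)) (op (CommAlgCat.of R C)) where
  smul := (CommAlgCat.ofHom ρ).op
  one_smul := by
    apply Quiver.Hom.unop_inj
    ext c
    exact (Algebra.TensorProduct.lid R C).injective ((h1 c).trans
      ((Algebra.TensorProduct.lid R C).apply_symm_apply c).symm)
  mul_smul := by
    apply Quiver.Hom.unop_inj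
    ext c
    exact (Algebra.TensorProduct.assoc R R R A A C).injective ((h2 c).trans
      ((Algebra.TensorProduct.assoc R R R A A C).apply_symm_apply _).symm)

/-- The action of `Spec A` on `Spec C` over `Spec R` given by a coaction `ρ : C → A ⊗ C`. -/
@[reducible]
def modSpec : ModObj ((Spec A).asOver (Spec R)) ((Spec C).asOver (Spec R)) :=
  letI := coactObj R A C ρ h1 h2
  modObjObj (algSpec R) (op (CommAlgCat.of R A)) (op (CommAlgCat.of R C))

lemma modSpec_left : (modSpec R A C ρ h1 h2).smul.left =
    (pullbackSpecIso R A C).hom ≫ Spec.map (CommRingCat.ofHom ρ.toRingHom) := rfl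

end SpecAction

section Torus

variable (k : Type u) [Field k] (X : Scheme.{u}) [IsIntegral X]

/-- The torus `T_X = Hom(Pic(X), k*)`, the diagonalizable group scheme with character group
`Pic(X)`: the spectrum of the group algebra `k[Pic(X)]`. -/
abbrev torus : Over (Spec (.of k)) :=
  (Spec (.of (AddMonoidAlgebra k (Pic X)))).asOver (Spec (.of k))

variable {X} [X.Over (Spec (.of k))] {r : ℕ} (L : Fin r → CartierDivisor X)

/-- The coaction on the graded piece of degree `m`. -/
def coactionPiece (m : Fin r → ℤ) :
    coxPiece k L m →ₗ[k] AddMonoidAlgebra k (Pic X) ⊗[k] Cox k L :=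
  (TensorProduct.mk k _ _ (AddMonoidAlgebra.single (toPic (multiDivisor L m)) 1)).comp
    (coxOf k L m)

/-- The coaction `Cox(X) → k[Pic(X)] ⊗ Cox(X)`, which maps `s` of degree `D` to `χ^D ⊗ s`, where
`χ^D` is the character of `T_X` given by the class of `D`. -/
def coaction : Cox k L →ₐ[k] AddMonoidAlgebra k (Pic X) ⊗[k] Cox k L :=
  DirectSum.toAlgebra k (fun m => coxPiece k L m) (coactionPiece k L)
    (by
      change AddMonoidAlgebra.single (toPic (multiDivisor L 0)) (1 : k) ⊗ₜ[k] (1 : Cox k L) = 1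
      rw [map_zero, map_zero, ← AddMonoidAlgebra.one_def, Algebra.TensorProduct.one_def])
    (by
      intro m n a b
      change AddMonoidAlgebra.single (toPic (multiDivisor L (m + n))) (1 : k) ⊗ₜ[k]
          (DirectSum.of (fun m => coxPiece k L m) (m + n)
            (GradedMonoid.GMul.mul (A := fun m => coxPiece k L m) a b) : Cox k L) =
        (AddMonoidAlgebra.single (toPic (multiDivisor L m)) (1 : k) ⊗ₜ[k] coxOf k L m a) *
          (AddMonoidAlgebra.single (toPic (multiDivisor L n)) (1 : k) ⊗ₜ[k] coxOf k L n b)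
      rw [Algebra.TensorProduct.tmul_mul_tmul, AddMonoidAlgebra.single_mul_single, mul_one,
        ← map_add, ← map_add, ← DirectSum.of_mul_of]
      rfl)

lemma coaction_coxOf (m : Fin r → ℤ) (s : coxPiece k L m) :
    coaction k L (coxOf k L m s) =
      AddMonoidAlgebra.single (toPic (multiDivisor L m)) 1 ⊗ₜ coxOf k L m s :=
  DirectSum.toAddMonoid_of (fun m => (coactionPiece k L m).toAddMonoidHom) m s

lemma coaction_counit (c : Cox k L) : Algebra.TensorProduct.lid k (Cox k L)
    (Algebra.TensorProduct.map (Bialgebra.counitAlgHom k (AddMonoidAlgebra k (Pic X)))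
      (AlgHom.id k (Cox k L)) (coaction k L c)) = c := by
  induction c using cox_induction with
  | zero => simp only [map_zero]
  | of m s =>
    rw [coaction_coxOf, Algebra.TensorProduct.map_tmul]
    simp
  | add x y hx hy =>
    rw [map_add, map_add, map_add, hx, hy]

lemma coaction_coassoc (c : Cox k L) :
    Algebra.TensorProduct.assoc k k k (AddMonoidAlgebra k (Pic X)) (AddMonoidAlgebra k (Pic X))
      (Cox k L) (Algebra.TensorProduct.map (Bialgebra.comulAlgHom k (AddMonoidAlgebra k (Pic X)))
        (AlgHom.id k (Cox k L)) (coaction k L c)) =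
    Algebra.TensorProduct.map (AlgHom.id k (AddMonoidAlgebra k (Pic X))) (coaction k L)
      (coaction k L c) := by
  induction c using cox_induction with
  | zero => simp only [map_zero]
  | of m s =>
    rw [coaction_coxOf, Algebra.TensorProduct.map_tmul, Algebra.TensorProduct.map_tmul,
      coaction_coxOf]
    simp
  | add x y hx hy =>
    rw [map_add, map_add, map_add, hx, hy, map_add]

/-- `X̄` as a scheme over `k`. -/
abbrev totalSpaceOver : Over (Spec (.of k)) := (totalSpace k L).asOver (Spec (.of k))

/-- The action of the torus `T_X` on `X̄`. -/
instance torusAction : ModObj (torus k X) (totalSpaceOver k L) :=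
  modSpec (.of k) (.of (AddMonoidAlgebra k (Pic X))) (.of (Cox k L)) (coaction k L)
    (coaction_counit k L) (coaction_coassoc k L)

/-- `X̂` as a scheme over `k`. -/
abbrev semistableOver (D : CartierDivisor X) : Over (Spec (.of k)) :=
  Over.mk ((semistable k L D).ι ≫ totalSpace k L ↘ Spec (.of k))

/-- The inclusion `X̂ → X̄`. -/
abbrev semistableInclusion (D : CartierDivisor X) : semistableOver k L D ⟶ totalSpaceOver k L :=
  Over.homMk (semistable k L D).ι

end Torus

section Quotients

variable {S : Scheme.{u}} (G : Over S) [MonObj G] {Y X : Over S} [ModObj G Y]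

/-- A subset of `Y` is invariant if its preimages under the action and under the projection
`G × Y → Y` coincide. -/
def IsInvariantSet (Z : Set Y.left) : Prop :=
  (γ[G, Y]).left ⁻¹' Z = (snd G Y).left ⁻¹' Z

/-- A function on an open subset of `Y` is invariant if its pullbacks under the action and under the
projection `G × Y → Y` coincide. -/
def IsInvariantSection {U : Y.left.Opens} (f : Γ(Y.left, U)) : Prop :=
  ∀ (W : (G ⊗ Y).left.Opens) (h₁ : W ≤ (γ[G, Y]).left ⁻¹ᵁ U) (h₂ : W ≤ (snd G Y).left ⁻¹ᵁ U),
    (γ[G, Y]).left.appLE U W h₁ f = (snd G Y).left.appLE U W h₂ f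

/-- `π : Y → X` is a good quotient of `Y` by the action of the group scheme `G`: it is invariant,
affine and surjective, the functions on an open subset `U` of `X` are the invariant functions on
`π⁻¹(U)`, and `π` maps closed invariant sets to closed sets, and disjoint ones to disjoint ones. -/
structure IsGoodQuotient (π : Y ⟶ X) : Prop where
  invariant : γ[G, Y] ≫ π = snd G Y ≫ π
  affine : IsAffineHom π.left
  surjective : Function.Surjective π.left
  injective_app : ∀ U : X.left.Opens, Function.Injective (π.left.app U)
  range_app : ∀ (U : X.left.Opens) (f : Γ(Y.left, π.left ⁻¹ᵁ U)),
    (∃ g, π.left.app U g = f) ↔ IsInvariantSection G f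
  isClosed_image : ∀ Z : Set Y.left, IsClosed Z → IsInvariantSet G Z → IsClosed (π.left '' Z)
  disjoint_image : ∀ Z Z' : Set Y.left, IsClosed Z → IsInvariantSet G Z → IsClosed Z' →
    IsInvariantSet G Z' → Disjoint Z Z' → Disjoint (π.left '' Z) (π.left '' Z')

/-- A good quotient `π : Y → X` is a good geometric quotient if its fibres are the orbits of `G`:
the morphism `(g, y) ↦ (g • y, y)` from `G × Y` to `Y ×_X Y` is surjective. -/
structure IsGoodGeometricQuotient (π : Y ⟶ X) : Prop extends IsGoodQuotient G π where
  orbits : Function.Surjective (Limits.pullback.lift (f := π.left) (g := π.left)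
    (γ[G, Y]).left (snd G Y).left (congrArg (fun φ => φ.left) invariant))

end Quotients

end CoxQuotient

end

/-! Write `K` for the function field and `a` for the coordinates of the class of the ample divisor
in the given basis, so that `∑ aᵢLᵢ` is ample as well. The Cox ring is the subring of the Laurent
polynomial ring `K[ℤʳ]` whose coefficients in degree `m` lie in `H⁰(X, ∑ mᵢLᵢ)`. A chart is a
section `s` of degree `n • a`, `n > 0`, whose nonvanishing locus `U` is affine and carries equations
`gᵢ` of all the `Lᵢ`. Sections over `U` extend to `X` after multiplication by a power of `s`
(`exists_mul_pow_mem_H0`). Hence `Cox[1/s]` contains every `f χᵐ` with `f gᵐ` regular on `U`. In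
particular it contains `𝒪(U)` in degree zero and the units `χᵐ g⁻ᵐ`. Since `f χᵐ = (χᵐ g⁻ᵐ)(f gᵐ)`,
this exhibits `D(s)` as the trivial torsor `T × U`: the substitution `χᵐ ↦ gᵐ` is a section over
`U`, and the units `χᵐ g⁻ᵐ` are the torus coordinate (`coord_mul_proj_sect`, `coord_neg_mul`). The
sets `U` cover `X` by ampleness (`exists_chart_mem`). That the sets `D(s)` cover `X̂` is the point
where properness enters (`exists_chart_notMem`): if a prime contained the sections of all charts but
not some section of degree `n • a`, a valuation ring produced from it would have a center on `X`,
and a chart around the center would give a contradiction. The maps `D(s) → U` agree on overlaps,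
because products of charts are charts (`quot_eq_quot`), and glue to an invariant morphism. The
preimage of `U` is exactly `D(s)` (`range_totalInclusion`), so the morphism is affine and locally a
trivial torsor. All the quotient properties follow formally from this
(`isGoodGeometricQuotient_of_localTrivialization`). -/

noncomputable section

namespace CoxQuotient

/-! ### Locally trivial torsors are good geometric quotients -/

section LocalTrivialization

open Limits

variable {S : Scheme.{u}} (G : Over S) [MonObj G] {Y X : Over S} [ModObj G Y]

/-- A trivialization of `π : Y ⟶ X` as a `G`-torsor over an open subscheme `base` of `X`: the
preimage `total` of `base` has a section `σ` and maps `τ`, `τ'` to `G` with `y = τ(y) • σ(π(y))` and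
`σ(π(y)) = τ'(y) • y`. -/
structure LocalTrivialization (π : Y ⟶ X) where
  base : Over S
  total : Over S
  u : base ⟶ X
  p : total ⟶ Y
  q : total ⟶ base
  σ : base ⟶ total
  τ : total ⟶ G
  τ' : total ⟶ G
  openImmersion_u : IsOpenImmersion u.left
  openImmersion_p : IsOpenImmersion p.left
  range_p : Set.range p.left = π.left ⁻¹' Set.range u.left
  comm : q ≫ u = p ≫ π
  section_q : σ ≫ q = 𝟙 base
  smul_eq : lift τ (q ≫ σ ≫ p) ≫ γ[G, Y] = p
  smul_eq' : lift τ' p ≫ γ[G, Y] = q ≫ σ ≫ p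

attribute [instance] LocalTrivialization.openImmersion_u LocalTrivialization.openImmersion_p

lemma appLE_congr {X Y : Scheme.{u}} {f g : X ⟶ Y} (h : f = g) {U : Y.Opens} {V : X.Opens}
    (e : V ≤ f ⁻¹ᵁ U) : f.appLE U V e = g.appLE U V (h ▸ e) := by
  subst h; rfl

lemma app_comp_appLE_congr {X Y Y' Z : Scheme.{u}} {f : X ⟶ Y} {g : Y ⟶ Z} {f' : X ⟶ Y'}
    {g' : Y' ⟶ Z} (h : f ≫ g = f' ≫ g') {U : Z.Opens} {V : X.Opens}
    (e : V ≤ f ⁻¹ᵁ g ⁻¹ᵁ U) (e' : V ≤ f' ⁻¹ᵁ g' ⁻¹ᵁ U) :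
    g.app U ≫ f.appLE _ V e = g'.app U ≫ f'.appLE _ V e' :=
  (Scheme.Hom.comp_appLE f g U V e).symm.trans
    ((appLE_congr h e).trans (Scheme.Hom.comp_appLE f' g' U V e'))

namespace LocalTrivialization

variable {G} {π : Y ⟶ X} (t : LocalTrivialization G π)

lemma σ_p_π : t.σ ≫ t.p ≫ π = t.u := by
  rw [← t.comm, ← Category.assoc, t.section_q, Category.id_comp]

lemma σ_p_π_left : (t.σ ≫ t.p).left ≫ π.left = t.u.left := by
  rw [← Over.comp_left, Category.assoc, t.σ_p_π]

/-- Pulling `π^* g` back along the section `σ` recovers `g` over the base. -/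
lemma eq_of_app_eq {V : X.left.Opens} {g g' : Γ(X.left, V)}
    (h : π.left.app V g = π.left.app V g') :
    X.left.presheaf.map (homOfLE (inf_le_left : V ⊓ t.u.left.opensRange ≤ V)).op g =
      X.left.presheaf.map (homOfLE (inf_le_left : V ⊓ t.u.left.opensRange ≤ V)).op g' := by
  set W := V ⊓ t.u.left.opensRange
  have hi : IsIso (t.u.left.app W) := Scheme.Hom.isIso_app _ _ inf_le_right
  have hW : W ≤ V := inf_le_left
  have e : t.u.left ⁻¹ᵁ W ≤ ((t.σ ≫ t.p).left ≫ π.left) ⁻¹ᵁ V := by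
    rw [t.σ_p_π_left]; exact t.u.left.preimage_mono hW
  have key : X.left.presheaf.map (homOfLE hW).op ≫ t.u.left.app W =
      π.left.app V ≫ (t.σ ≫ t.p).left.appLE (π.left ⁻¹ᵁ V) (t.u.left ⁻¹ᵁ W) e := by
    rw [← Scheme.Hom.comp_appLE, appLE_congr t.σ_p_π_left, Scheme.Hom.app_eq_appLE,
      Scheme.Hom.map_appLE]
  apply ((ConcreteCategory.bijective_of_isIso (t.u.left.app W)).1)
  rw [← ConcreteCategory.comp_apply, ← ConcreteCategory.comp_apply, key,
    ConcreteCategory.comp_apply, h, ConcreteCategory.comp_apply]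

/-- The points `y` and `σ(π(y))` lie in one orbit, so an invariant function has the same value at
both: pull the invariance identity back along `(τ, σ ∘ π)`. -/
lemma appLE_eq_of_isInvariantSection {V : X.left.Opens} {f : Γ(Y.left, π.left ⁻¹ᵁ V)}
    (hπ : γ[G, Y] ≫ π = snd G Y ≫ π) (hf : IsInvariantSection G f) {W : t.total.left.Opens}
    (h₁ : W ≤ t.p.left ⁻¹ᵁ π.left ⁻¹ᵁ V) (h₂ : W ≤ (t.q ≫ t.σ ≫ t.p).left ⁻¹ᵁ π.left ⁻¹ᵁ V) :
    t.p.left.appLE _ W h₁ f = (t.q ≫ t.σ ≫ t.p).left.appLE _ W h₂ f := by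
  have e₁ : (lift t.τ (t.q ≫ t.σ ≫ t.p)).left ≫ (γ[G, Y]).left = t.p.left :=
    congrArg (fun φ => φ.left) t.smul_eq
  have e₂ : (lift t.τ (t.q ≫ t.σ ≫ t.p)).left ≫ (snd G Y).left = (t.q ≫ t.σ ≫ t.p).left :=
    congrArg (fun φ => φ.left) (lift_snd t.τ (t.q ≫ t.σ ≫ t.p))
  have e₃ : (γ[G, Y]).left ≫ π.left = (snd G Y).left ≫ π.left :=
    congrArg (fun φ => φ.left) hπ
  -- By invariance of `π`, the whole preimage under the action is an admissible `W` in
  -- `IsInvariantSection`.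
  have h₃ : (γ[G, Y]).left ⁻¹ᵁ π.left ⁻¹ᵁ V ≤ (snd G Y).left ⁻¹ᵁ π.left ⁻¹ᵁ V := by
    rw [← Scheme.Hom.comp_preimage, ← Scheme.Hom.comp_preimage, e₃]
  have h₄ : W ≤ (lift t.τ (t.q ≫ t.σ ≫ t.p)).left ⁻¹ᵁ (γ[G, Y]).left ⁻¹ᵁ π.left ⁻¹ᵁ V := by
    rw [← Scheme.Hom.comp_preimage, e₁]; exact h₁
  have := hf _ le_rfl h₃
  have := congrArg ((lift t.τ (t.q ≫ t.σ ≫ t.p)).left.appLE _ W h₄) this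
  rw [← ConcreteCategory.comp_apply, ← ConcreteCategory.comp_apply, Scheme.Hom.appLE_comp_appLE,
    Scheme.Hom.appLE_comp_appLE, appLE_congr e₁, appLE_congr e₂] at this
  exact this

/-- The descended function is `σ^* f`; its pullback is `y ↦ f(σ(π(y)))`, which equals `f` by the
preceding lemma. -/
lemma exists_app_eq {V : X.left.Opens} {f : Γ(Y.left, π.left ⁻¹ᵁ V)}
    (hπ : γ[G, Y] ≫ π = snd G Y ≫ π) (hf : IsInvariantSection G f) :
    ∃ g : Γ(X.left, V ⊓ t.u.left.opensRange), π.left.app _ g =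
      Y.left.presheaf.map (homOfLE (π.left.preimage_mono inf_le_left)).op f := by
  set W := V ⊓ t.u.left.opensRange
  have hW : W ≤ V := inf_le_left
  have hi : IsIso (t.u.left.app W) := Scheme.Hom.isIso_app _ _ inf_le_right
  have hp : π.left ⁻¹ᵁ W ≤ t.p.left.opensRange := by
    intro y hy
    change y ∈ Set.range t.p.left
    rw [t.range_p]
    exact hy.2
  have hj : IsIso (t.p.left.app (π.left ⁻¹ᵁ W)) := Scheme.Hom.isIso_app _ _ hp
  have e : t.u.left ⁻¹ᵁ W ≤ (t.σ ≫ t.p).left ⁻¹ᵁ π.left ⁻¹ᵁ V := by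
    rw [← Scheme.Hom.comp_preimage, t.σ_p_π_left]; exact t.u.left.preimage_mono hW
  have hc : t.p.left ≫ π.left = t.q.left ≫ t.u.left :=
    congrArg (fun φ => φ.left) t.comm.symm
  have e' : t.p.left ⁻¹ᵁ π.left ⁻¹ᵁ W ≤ t.q.left ⁻¹ᵁ t.u.left ⁻¹ᵁ W := by
    rw [← Scheme.Hom.comp_preimage, ← Scheme.Hom.comp_preimage, hc]
  obtain ⟨g, hg⟩ := (ConcreteCategory.bijective_of_isIso (t.u.left.app W)).2
    ((t.σ ≫ t.p).left.appLE (π.left ⁻¹ᵁ V) (t.u.left ⁻¹ᵁ W) e f)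
  refine ⟨g, (ConcreteCategory.bijective_of_isIso (t.p.left.app (π.left ⁻¹ᵁ W))).1 ?_⟩
  have h1 : π.left.app W ≫ t.p.left.app (π.left ⁻¹ᵁ W) =
      t.u.left.app W ≫ t.q.left.appLE _ _ e' := by
    rw [Scheme.Hom.app_eq_appLE t.p.left]
    exact app_comp_appLE_congr hc _ _
  have h2 : Y.left.presheaf.map (homOfLE (π.left.preimage_mono hW)).op ≫
      t.p.left.app (π.left ⁻¹ᵁ W) = t.p.left.appLE _ _
        (t.p.left.preimage_mono (π.left.preimage_mono hW)) := by
    rw [Scheme.Hom.app_eq_appLE t.p.left, Scheme.Hom.map_appLE]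
  rw [← ConcreteCategory.comp_apply, ← ConcreteCategory.comp_apply, h1, h2,
    ConcreteCategory.comp_apply, hg, ← ConcreteCategory.comp_apply, Scheme.Hom.appLE_comp_appLE,
    t.appLE_eq_of_isInvariantSection hπ hf]
  rfl

/-- If `π(y₁) = π(y₂)` lies in the base, then `y₁ = τ(y₁)τ'(y₂) • y₂`. This formula is a section of
the orbit map over an open subscheme of the fibre product, so every point there is hit, not only the
rational ones. -/
lemma exists_orbit_map (z : ↥(pullback π.left π.left))
    (hz : π.left (pullback.fst π.left π.left z) ∈ Set.range t.u.left)
    (hπ : γ[G, Y] ≫ π = snd G Y ≫ π) :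
    ∃ w, pullback.lift (f := π.left) (g := π.left) (γ[G, Y]).left (snd G Y).left
      (congrArg (fun φ => φ.left) hπ) w = z := by
  let O : (pullback π.left π.left).Opens :=
    (pullback.fst π.left π.left ≫ π.left) ⁻¹ᵁ t.u.left.opensRange
  let O' : Over S := Over.mk (O.ι ≫ pullback.fst π.left π.left ≫ Y.hom)
  have hs : pullback.snd π.left π.left ≫ Y.hom = pullback.fst π.left π.left ≫ Y.hom := by
    rw [← Over.w π, pullback.condition_assoc]
  have h1 : Set.range (O.ι ≫ pullback.fst π.left π.left) ⊆ Set.range t.p.left := by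
    rw [t.range_p]
    rintro _ ⟨a, rfl⟩
    exact a.2
  have h2 : Set.range (O.ι ≫ pullback.snd π.left π.left) ⊆ Set.range t.p.left := by
    rw [t.range_p]
    rintro _ ⟨a, rfl⟩
    have : (pullback.fst π.left π.left ≫ π.left) (O.ι a) ∈ Set.range t.u.left := a.2
    rw [pullback.condition] at this
    exact this
  let y₁ : O' ⟶ t.total := Over.homMk (IsOpenImmersion.lift t.p.left _ h1) (by
    rw [← Over.w t.p, IsOpenImmersion.lift_fac_assoc, Category.assoc]; rfl)
  let y₂ : O' ⟶ t.total := Over.homMk (IsOpenImmersion.lift t.p.left _ h2) (by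
    rw [← Over.w t.p, IsOpenImmersion.lift_fac_assoc, Category.assoc, hs]; rfl)
  have hy₁ : (y₁ ≫ t.p).left = O.ι ≫ pullback.fst π.left π.left :=
    IsOpenImmersion.lift_fac _ _ _
  have hy₂ : (y₂ ≫ t.p).left = O.ι ≫ pullback.snd π.left π.left :=
    IsOpenImmersion.lift_fac _ _ _
  have hq : y₁ ≫ t.q = y₂ ≫ t.q := by
    have : (y₁ ≫ t.q ≫ t.u).left = (y₂ ≫ t.q ≫ t.u).left := by
      rw [t.comm, ← Category.assoc, ← Category.assoc, Over.comp_left, Over.comp_left _ _ _ _ π,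
        hy₁, hy₂, Category.assoc, Category.assoc, pullback.condition]
    ext1
    rw [← cancel_mono t.u.left, ← Over.comp_left, ← Over.comp_left, Category.assoc, this,
      Category.assoc]
  -- The section `(y₁, y₂) ↦ (τ(y₁)τ'(y₂), y₂)` of the orbit map.
  let ψ : O' ⟶ G ⊗ Y := lift (lift (y₁ ≫ t.τ) (y₂ ≫ t.τ') ≫ μ[G]) (y₂ ≫ t.p)
  have hψγ : ψ ≫ γ[G, Y] = y₁ ≫ t.p := by
    have e : ψ = lift (lift (y₁ ≫ t.τ) (y₂ ≫ t.τ')) (y₂ ≫ t.p) ≫ μ[G] ▷ Y := by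
      ext <;> simp [ψ]
    rw [e, Category.assoc, ModObj.mul_smul_self]
    have e2 : lift (lift (y₁ ≫ t.τ) (y₂ ≫ t.τ')) (y₂ ≫ t.p) ≫ (α_ G G Y).hom ≫ G ◁ γ[G, Y] =
        lift (y₁ ≫ t.τ) (y₂ ≫ lift t.τ' t.p ≫ γ[G, Y]) := by
      rw [← Category.assoc, lift_lift_associator_hom, lift_whiskerLeft, ← Category.assoc y₂,
        comp_lift]
    rw [← Category.assoc (α_ G G Y).hom, ← Category.assoc, e2, t.smul_eq', ← Category.assoc y₂,
      ← hq, Category.assoc, ← comp_lift, Category.assoc, t.smul_eq]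
  have hψs : ψ ≫ snd G Y = y₂ ≫ t.p := lift_snd _ _
  have hfac : ψ.left ≫ pullback.lift (f := π.left) (g := π.left) (γ[G, Y]).left (snd G Y).left
      (congrArg (fun φ => φ.left) hπ) = O.ι := by
    apply pullback.hom_ext
    · rw [Category.assoc, pullback.lift_fst, ← Over.comp_left, hψγ, hy₁]
    · rw [Category.assoc, pullback.lift_snd, ← Over.comp_left, hψs, hy₂]
  exact ⟨ψ.left ⟨z, hz⟩, congrArg (fun φ => φ (⟨z, hz⟩ : O)) hfac⟩

end LocalTrivialization

/-- An invariant affine morphism that is locally on the target a trivial torsor is a good geometric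
quotient. -/
theorem isGoodGeometricQuotient_of_localTrivialization {π : Y ⟶ X}
    (hπ : γ[G, Y] ≫ π = snd G Y ≫ π) (haff : IsAffineHom π.left)
    (htriv : ∀ x : X.left, ∃ t : LocalTrivialization G π, x ∈ Set.range t.u.left) :
    IsGoodGeometricQuotient G π := by
  choose t ht using htriv
  have hinj : ∀ U : X.left.Opens, Function.Injective (π.left.app U) := by
    intro U g g' h
    refine TopCat.Sheaf.eq_of_locally_eq' X.left.sheaf
      (fun x : U => U ⊓ (t x.1).u.left.opensRange) U (fun x => homOfLE inf_le_left) ?_ g g'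
      fun x => (t x.1).eq_of_app_eq h
    intro x hx
    rw [Opens.mem_iSup]
    exact ⟨⟨x, hx⟩, hx, ht x⟩
  have hgeom : Function.Surjective (pullback.lift (f := π.left) (g := π.left)
      (γ[G, Y]).left (snd G Y).left (congrArg (fun φ => φ.left) hπ)) :=
    fun z => (t _).exists_orbit_map z (ht _) hπ
  -- Invariant sets are unions of fibres: lift `(y, z)` to a point of the fibre product and then to
  -- `G × Y`.
  have horb : ∀ Z : Set Y.left, IsInvariantSet G Z → ∀ y z, y ∈ Z → π.left y = π.left z →
      z ∈ Z := by
    intro Z hZ y z hy hyz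
    obtain ⟨a, ha₁, ha₂⟩ := Scheme.Pullback.exists_preimage_pullback (f := π.left) (g := π.left)
      y z hyz
    obtain ⟨w, rfl⟩ := hgeom a
    rw [← Scheme.Hom.comp_apply, pullback.lift_fst] at ha₁
    rw [← Scheme.Hom.comp_apply, pullback.lift_snd] at ha₂
    have : w ∈ (γ[G, Y]).left ⁻¹' Z := by rw [Set.mem_preimage, ha₁]; exact hy
    rw [hZ] at this
    rw [← ha₂]
    exact this
  refine ⟨⟨hπ, haff, ?_, hinj, ?_, ?_, ?_⟩, hgeom⟩
  · intro x
    obtain ⟨a, ha⟩ := ht x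
    refine ⟨((t x).σ ≫ (t x).p).left a, ?_⟩
    rw [← Scheme.Hom.comp_apply, (t x).σ_p_π_left, ha]
  · intro U f
    constructor
    · rintro ⟨g, rfl⟩ W h₁ h₂
      exact ConcreteCategory.congr_hom (app_comp_appLE_congr (congrArg (fun φ => φ.left) hπ :
        (γ[G, Y]).left ≫ π.left = (snd G Y).left ≫ π.left) h₁ h₂) g
    · intro hf
      choose g hg using fun x : U => (t x.1).exists_app_eq hπ hf
      have hcov : U ≤ iSup fun x : U => U ⊓ (t x.1).u.left.opensRange := by
        intro x hx
        rw [Opens.mem_iSup]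
        exact ⟨⟨x, hx⟩, hx, ht x⟩
      -- The local descents agree on overlaps because pullback by `π` is injective and they all pull
      -- back to restrictions of `f`.
      obtain ⟨s, hs, -⟩ := TopCat.Sheaf.existsUnique_gluing' X.left.sheaf
        (fun x : U => U ⊓ (t x.1).u.left.opensRange) U (fun x => homOfLE inf_le_left) hcov g (by
          intro x y
          apply hinj
          refine (ConcreteCategory.congr_hom (π.left.naturality (homOfLE inf_le_left).op)
            (g x)).trans (Eq.trans ?_ (ConcreteCategory.congr_hom (π.left.naturality
              (homOfLE inf_le_right).op) (g y)).symm)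
          rw [ConcreteCategory.comp_apply, ConcreteCategory.comp_apply, hg, hg,
            ← ConcreteCategory.comp_apply, ← ConcreteCategory.comp_apply]
          erw [← Functor.map_comp, ← Functor.map_comp]
          rfl)
      refine ⟨s, ?_⟩
      refine TopCat.Sheaf.eq_of_locally_eq' Y.left.sheaf
        (fun x : U => π.left ⁻¹ᵁ (U ⊓ (t x.1).u.left.opensRange)) (π.left ⁻¹ᵁ U)
        (fun x => homOfLE (π.left.preimage_mono inf_le_left)) ?_ _ _ fun x => ?_
      · intro y hy
        obtain ⟨i, hi⟩ := (Opens.mem_iSup).1 (hcov hy)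
        exact (Opens.mem_iSup).2 ⟨i, hi⟩
      · refine Eq.trans ?_ (hg x)
        rw [← hs x]
        exact (ConcreteCategory.congr_hom (π.left.naturality
          (homOfLE (inf_le_left : U ⊓ (t x.1).u.left.opensRange ≤ U)).op) s).symm
  · intro Z hZ hinv
    rw [isClosed_iff_nhds]
    intro x hx
    obtain ⟨a, ha⟩ := ht x
    have hcl : IsClosed (((t x).σ ≫ (t x).p).left ⁻¹' Z) :=
      hZ.preimage ((t x).σ ≫ (t x).p).left.continuous
    -- Over the base, the image of a saturated set is its preimage under the section, hence closed;
    -- closedness of the image is local on `X`.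
    have heq : ((t x).σ ≫ (t x).p).left ⁻¹' Z = (t x).u.left ⁻¹' (π.left '' Z) := by
      ext b
      have hb : π.left (((t x).σ ≫ (t x).p).left b) = (t x).u.left b := by
        rw [← Scheme.Hom.comp_apply, (t x).σ_p_π_left]
      constructor
      · exact fun h => ⟨_, h, hb⟩
      · rintro ⟨z, hz, hzb⟩
        exact horb Z hinv z _ hz (hzb.trans hb.symm)
    rw [heq] at hcl
    rw [← ha]
    refine isClosed_iff_nhds.1 hcl a fun N hN => ?_
    have hN' := (t x).u.left.isOpenEmbedding.isOpenMap.image_mem_nhds hN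
    rw [ha] at hN'
    have := hx ((t x).u.left '' N) hN'
    obtain ⟨_, ⟨c, hc, rfl⟩, hc'⟩ := this
    exact ⟨c, hc, hc'⟩
  · intro Z Z' hZ hinv hZ' hinv' hd
    rw [Set.disjoint_left]
    rintro _ ⟨z, hz, rfl⟩ ⟨z', hz', h⟩
    exact (Set.disjoint_left.1 hd) hz (horb Z' hinv' z' z hz' h)

end LocalTrivialization

end CoxQuotient

end
noncomputable section

namespace CoxQuotient

/-! ### Affine test schemes, the torus action on points, restriction of actions -/

section AffineTests

variable {k : Type u} [Field k]

/-- The morphism of affine `k`-schemes given by a homomorphism of `k`-algebras. -/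
def specMap {A B : Type u} [CommRing A] [CommRing B] [Algebra k A] [Algebra k B] (f : A →ₐ[k] B) :
    (Spec (.of B)).asOver (Spec (.of k)) ⟶ (Spec (.of A)).asOver (Spec (.of k)) :=
  Over.homMk (Spec.map (CommRingCat.ofHom f.toRingHom)) (by
    change Spec.map _ ≫ Spec.map _ = Spec.map _
    rw [← Spec.map_comp, ← CommRingCat.ofHom_comp]
    exact congrArg (fun φ => Spec.map (CommRingCat.ofHom φ)) f.comp_algebraMap)

lemma specMap_comp {A B C : Type u} [CommRing A] [CommRing B] [CommRing C] [Algebra k A]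
    [Algebra k B] [Algebra k C] (f : A →ₐ[k] B) (g : B →ₐ[k] C) :
    specMap (g.comp f) = specMap g ≫ specMap f := by
  ext1
  exact Spec.map_comp (CommRingCat.ofHom f.toRingHom) (CommRingCat.ofHom g.toRingHom)

lemma specMap_id (A : Type u) [CommRing A] [Algebra k A] :
    specMap (AlgHom.id k A) = 𝟙 _ := by
  ext1
  exact Spec.map_id _

lemma exists_specMap_eq {A B : Type u} [CommRing A] [CommRing B] [Algebra k A] [Algebra k B]
    (φ : (Spec (.of B)).asOver (Spec (.of k)) ⟶ (Spec (.of A)).asOver (Spec (.of k))) :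
    ∃ f : A →ₐ[k] B, specMap f = φ := by
  obtain ⟨g, hg⟩ := Spec.map_surjective φ.left
  have h := Over.w φ
  rw [← hg] at h
  change Spec.map g ≫ Spec.map _ = Spec.map _ at h
  rw [← Spec.map_comp] at h
  have h' := Spec.map_injective h
  refine ⟨⟨g.hom, fun c => ?_⟩, ?_⟩
  · exact congrArg (fun φ => φ.hom c) h'
  · ext1
    exact hg

/-- Two morphisms of `k`-schemes agree if they agree on all affine test schemes that map to a member
of a given open cover. -/
lemma over_hom_ext_of_affine {W Z : Over (Spec (.of k))} {f g : W ⟶ Z} {I : Type*}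
    (O : I → W.left.Opens) (hO : ∀ w, ∃ i, w ∈ O i)
    (h : ∀ (i : I) (B : Type u) [CommRing B] [Algebra k B]
      (a : (Spec (.of B)).asOver (Spec (.of k)) ⟶ W),
      Set.range a.left ⊆ O i → a ≫ f = a ≫ g) : f = g := by
  ext1
  refine Scheme.hom_ext_of_forall _ _ fun w => ?_
  obtain ⟨i, hi⟩ := hO w
  obtain ⟨_, ⟨V, hV, rfl⟩, hwV, hVO⟩ :=
    W.left.isBasis_affineOpens.exists_subset_of_mem_open hi (O i).isOpen
  have hV : IsAffineOpen V := hV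
  refine ⟨V, hwV, ?_⟩
  obtain ⟨ψ, hψ⟩ := Spec.map_surjective (hV.fromSpec ≫ W.hom)
  let _ : Algebra k Γ(W.left, V) := ψ.hom.toAlgebra
  let a : (Spec (.of Γ(W.left, V))).asOver (Spec (.of k)) ⟶ W := Over.homMk hV.fromSpec hψ.symm
  have ha := h i _ a (by
    change Set.range hV.fromSpec ⊆ _
    rw [hV.range_fromSpec]
    exact hVO)
  have ha' : hV.fromSpec ≫ f.left = hV.fromSpec ≫ g.left := congrArg (fun φ => φ.left) ha
  rw [← hV.isoSpec_hom_fromSpec, Category.assoc, ha', Category.assoc]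

lemma pullback_lift_specMap {A B C : Type u} [CommRing A] [CommRing B] [CommRing C] [Algebra k A]
    [Algebra k B] [Algebra k C] (α : A →ₐ[k] B) (β : C →ₐ[k] B)
    (h : Spec.map (CommRingCat.ofHom α.toRingHom) ≫ Spec.map (CommRingCat.ofHom (algebraMap k A)) =
      Spec.map (CommRingCat.ofHom β.toRingHom) ≫ Spec.map (CommRingCat.ofHom (algebraMap k C))) :
    Limits.pullback.lift _ _ h =
      Spec.map (CommRingCat.ofHom
        (Algebra.TensorProduct.lift α β fun _ _ => Commute.all _ _).toRingHom) ≫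
        (pullbackSpecIso k A C).inv := by
  apply Limits.pullback.hom_ext
  · rw [Limits.pullback.lift_fst, Category.assoc, pullbackSpecIso_inv_fst, ← Spec.map_comp]
    congr 1
    ext x
    simp
  · rw [Limits.pullback.lift_snd, Category.assoc, pullbackSpecIso_inv_snd, ← Spec.map_comp]
    congr 1
    ext x
    simp

end AffineTests

section TorusAction

variable {k : Type u} [Field k] {X : Scheme.{u}} [IsIntegral X] [X.Over (Spec (.of k))] {r : ℕ}
  (L : Fin r → CartierDivisor X)

/-- On `B`-valued points the action is `(α, β) ↦ (α ⊗ β) ∘ coaction`; the identification of the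
fibre product with the spectrum of the tensor product cancels. -/
lemma lift_specMap_smul {B : Type u} [CommRing B] [Algebra k B]
    (α : AddMonoidAlgebra k (Pic X) →ₐ[k] B) (β : Cox k L →ₐ[k] B) :
    lift (specMap α : _ ⟶ torus k X) (specMap β : _ ⟶ totalSpaceOver k L) ≫
        γ[torus k X, totalSpaceOver k L] =
      specMap ((Algebra.TensorProduct.lift α β fun _ _ => Commute.all _ _).comp (coaction k L)) := by
  have e1 : (γ[torus k X, totalSpaceOver k L]).left =
      (pullbackSpecIso k (AddMonoidAlgebra k (Pic X)) (Cox k L)).hom ≫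
        Spec.map (CommRingCat.ofHom (coaction k L).toRingHom) := rfl
  have e2 : (lift (specMap α : _ ⟶ torus k X) (specMap β : _ ⟶ totalSpaceOver k L)).left =
      Spec.map (CommRingCat.ofHom
        (Algebra.TensorProduct.lift α β fun _ _ => Commute.all _ _).toRingHom) ≫
        (pullbackSpecIso k (AddMonoidAlgebra k (Pic X)) (Cox k L)).inv :=
    pullback_lift_specMap α β ((Over.w (specMap α)).trans (Over.w (specMap β)).symm)
  have e3 (Z : Scheme.{u}) (z : Spec (.of (AddMonoidAlgebra k (Pic X) ⊗[k] Cox k L)) ⟶ Z) :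
      (Spec.map (CommRingCat.ofHom
        (Algebra.TensorProduct.lift α β fun _ _ => Commute.all _ _).toRingHom) ≫
        (pullbackSpecIso k (AddMonoidAlgebra k (Pic X)) (Cox k L)).inv) ≫
        (pullbackSpecIso k (AddMonoidAlgebra k (Pic X)) (Cox k L)).hom ≫ z =
      Spec.map (CommRingCat.ofHom
        (Algebra.TensorProduct.lift α β fun _ _ => Commute.all _ _).toRingHom) ≫ z := by
    rw [Category.assoc, Iso.inv_hom_id_assoc]
  ext1
  rw [Over.comp_left, e1, e2]
  refine (e3 _ _).trans ?_
  exact (Spec.map_comp (CommRingCat.ofHom (coaction k L).toRingHom) (CommRingCat.ofHom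
    (Algebra.TensorProduct.lift α β fun _ _ => Commute.all _ _).toRingHom)).symm

lemma lift_comp_coaction_coxOf {B : Type u} [CommRing B] [Algebra k B]
    (α : AddMonoidAlgebra k (Pic X) →ₐ[k] B) (β : Cox k L →ₐ[k] B) (m : Fin r → ℤ)
    (s : coxPiece k L m) :
    ((Algebra.TensorProduct.lift α β fun _ _ => Commute.all _ _).comp (coaction k L))
      (coxOf k L m s) =
    α (AddMonoidAlgebra.single (toPic (multiDivisor L m)) 1) * β (coxOf k L m s) := by
  rw [AlgHom.comp_apply, coaction_coxOf, Algebra.TensorProduct.lift_tmul]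

end TorusAction

section SubAction

variable {C : Type*} [Category C] [CartesianMonoidalCategory C] {G Y Y' : C} [MonObj G]
  [ModObj G Y]

/-- The restriction of an action along a monomorphism `i : Y' ⟶ Y` through which it factors. -/
@[reducible]
def ModObj.ofMono (i : Y' ⟶ Y) [Mono i] (a : G ⊗ Y' ⟶ Y') (h : a ≫ i = G ◁ i ≫ γ[G, Y]) :
    ModObj G Y' where
  smul := a
  one_smul := by
    change η[G] ▷ Y' ≫ a = (λ_ Y').hom
    rw [← cancel_mono i, Category.assoc, h, ← whisker_exchange_assoc, ModObj.one_smul_self,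
      leftUnitor_naturality]
  mul_smul := by
    change μ[G] ▷ Y' ≫ a = (α_ G G Y').hom ≫ G ◁ a ≫ a
    rw [← cancel_mono i, Category.assoc, Category.assoc, Category.assoc, h,
      ← whisker_exchange_assoc, ModObj.mul_smul_self, ← MonoidalCategory.whiskerLeft_comp_assoc, h]
    simp

end SubAction

end CoxQuotient

end
noncomputable section

namespace CoxQuotient

/-! ### Sections as rational functions -/

section RegularFunctions

variable {X : Scheme.{u}} [IsIntegral X]

variable (X) in
/-- The rational functions that are regular at `x`. -/
def regularAt (x : X) : Subring X.functionField :=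
  (algebraMap (X.presheaf.stalk x) X.functionField).range

/-- The rational function given by a section over a nonempty open subset. -/
def toFunctionField (U : X.Opens) (hU : genericPoint X ∈ U) : Γ(X, U) →+* X.functionField :=
  (X.presheaf.germ U _ hU).hom

lemma genericPoint_mem {U : X.Opens} {x : X} (hx : x ∈ U) : genericPoint X ∈ U :=
  (genericPoint_specializes x).mem_open U.isOpen hx

lemma algebraMap_germ {U : X.Opens} {x : X} (hx : x ∈ U) (hU : genericPoint X ∈ U)
    (a : Γ(X, U)) : algebraMap (X.presheaf.stalk x) X.functionField (X.presheaf.germ U x hx a) =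
      toFunctionField U hU a :=
  have : Nonempty U := ⟨⟨x, hx⟩⟩
  Scheme.algebraMap_germ_eq_germToFunctionField X hx a

lemma toFunctionField_injective (U : X.Opens) (hU : genericPoint X ∈ U) :
    Function.Injective (toFunctionField U hU) :=
  germ_injective_of_isIntegral X _ hU

lemma toFunctionField_res {U V : X.Opens} (h : V ≤ U) (hV : genericPoint X ∈ V) (a : Γ(X, U)) :
    toFunctionField V hV (X.presheaf.map (homOfLE h).op a) = toFunctionField U (h hV) a :=
  X.presheaf.germ_res_apply (homOfLE h) _ hV a

lemma toFunctionField_mem_regularAt {U : X.Opens} {x : X} (hx : x ∈ U)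
    (hU : genericPoint X ∈ U) (a : Γ(X, U)) : toFunctionField U hU a ∈ regularAt X x :=
  ⟨_, algebraMap_germ hx hU a⟩

/-- Lets membership in basic open sets be tested inside the function field. -/
lemma isUnit_iff_inv_mem_regularAt {x : X} (a : X.presheaf.stalk x) :
    IsUnit a ↔ algebraMap (X.presheaf.stalk x) X.functionField a ≠ 0 ∧
      (algebraMap (X.presheaf.stalk x) X.functionField a)⁻¹ ∈ regularAt X x := by
  have hinj : Function.Injective (algebraMap (X.presheaf.stalk x) X.functionField) :=
    IsFractionRing.injective _ _
  constructor
  · rintro ⟨v, rfl⟩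
    have h : algebraMap (X.presheaf.stalk x) X.functionField v *
        algebraMap (X.presheaf.stalk x) X.functionField (v⁻¹ : (X.presheaf.stalk x)ˣ) = 1 := by
      rw [← map_mul, Units.mul_inv, map_one]
    exact ⟨left_ne_zero_of_mul_eq_one h, _, eq_inv_of_mul_eq_one_right h⟩
  · rintro ⟨h0, b, hb⟩
    refine IsUnit.of_mul_eq_one b (hinj ?_)
    rw [map_mul, hb, mul_inv_cancel₀ h0, map_one]

/-- A rational function that is regular on `D(σ) ⊆ U` becomes regular on the affine open set `U`
after multiplication by a power of `σ`. -/
lemma exists_pow_mul_eq_toFunctionField {U : X.Opens} (hU : IsAffineOpen U)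
    (hη : genericPoint X ∈ U) (σ : Γ(X, U)) (f : X.functionField)
    (hf : ∀ x (hx : x ∈ U), IsUnit (X.presheaf.germ U x hx σ) → f ∈ regularAt X x) :
    ∃ (N : ℕ) (a : Γ(X, U)), toFunctionField U hη a = f * toFunctionField U hη σ ^ N := by
  -- The ideal of denominators of `f`; the claim is that it contains a power of `σ`.
  let I : Ideal Γ(X, U) :=
    { carrier := {a | ∃ b, toFunctionField U hη b = f * toFunctionField U hη a}
      zero_mem' := ⟨0, by simp⟩
      add_mem' := by
        rintro a a' ⟨b, hb⟩ ⟨b', hb'⟩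
        exact ⟨b + b', by rw [map_add, hb, hb', map_add, mul_add]⟩
      smul_mem' := by
        rintro c a ⟨b, hb⟩
        exact ⟨c * b, by rw [map_mul, hb, smul_eq_mul, map_mul]; ring⟩ }
  -- A prime containing `I` but not `σ` is a point of `D(σ)`. There `f` is regular, hence a fraction
  -- whose denominator lies in `I` and outside the prime.
  have hσ : σ ∈ I.radical := by
    rw [Ideal.radical_eq_sInf, Submodule.mem_sInf]
    rintro p ⟨hIp, hp⟩
    by_contra hσp
    let y : PrimeSpectrum Γ(X, U) := ⟨p, hp⟩
    have hy : hU.fromSpec y ∈ U := by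
      have : hU.fromSpec y ∈ Set.range hU.fromSpec := ⟨y, rfl⟩
      rwa [hU.range_fromSpec] at this
    let _ : Algebra Γ(X, U) (X.presheaf.stalk (hU.fromSpec y)) :=
      TopCat.Presheaf.algebra_section_stalk X.presheaf ⟨hU.fromSpec y, hy⟩
    have hloc : IsLocalization.AtPrime (X.presheaf.stalk (hU.fromSpec y)) y.asIdeal :=
      hU.isLocalization_stalk' y hy
    have hunit : IsUnit (X.presheaf.germ U (hU.fromSpec y) hy σ) :=
      IsLocalization.map_units (M := y.asIdeal.primeCompl) (X.presheaf.stalk (hU.fromSpec y)) ⟨σ, hσp⟩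
    obtain ⟨a, ha⟩ := hf _ hy hunit
    obtain ⟨⟨b, c⟩, hbc⟩ := IsLocalization.surj y.asIdeal.primeCompl a
    refine c.2 (hIp ⟨b, ?_⟩)
    rw [← ha, ← algebraMap_germ hy hη, ← algebraMap_germ hy hη, ← map_mul]
    exact congrArg _ hbc.symm
  obtain ⟨N, b, hb⟩ := hσ
  exact ⟨N, b, by rw [hb, map_pow]⟩

lemma exists_toFunctionField_eq {U : X.Opens} (hU : IsAffineOpen U) (hη : genericPoint X ∈ U)
    (f : X.functionField) (hf : ∀ x ∈ U, f ∈ regularAt X x) :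
    ∃ a, toFunctionField U hη a = f := by
  obtain ⟨N, a, ha⟩ := exists_pow_mul_eq_toFunctionField hU hη 1 f fun x hx _ => hf x hx
  exact ⟨a, by rw [ha, map_one, one_pow, mul_one]⟩

end RegularFunctions

/-! ### Local equations and nonvanishing of sections -/

section LocalEquations

variable {X : Scheme.{u}} [IsIntegral X]

lemma IsLocalEquation.zsmul {D : CartierDivisor X} {x : X} {g : (X.functionField)ˣ}
    (hg : IsLocalEquation D x g) (n : ℤ) : IsLocalEquation (n • D) x (g ^ n) := by
  unfold IsLocalEquation at *
  rw [map_zsmul, hg, ofMul_zpow, map_zsmul]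

lemma IsLocalEquation.nsmul {D : CartierDivisor X} {x : X} {g : (X.functionField)ˣ}
    (hg : IsLocalEquation D x g) (n : ℕ) : IsLocalEquation (n • D) x (g ^ n) := by
  unfold IsLocalEquation at *
  rw [map_nsmul, hg, ofMul_pow, map_nsmul]

lemma isLocalEquation_principalDivisor (x : X) (g : (X.functionField)ˣ) :
    IsLocalEquation (principalDivisor X (Additive.ofMul g)) x g := rfl

lemma isLocalEquation_multiDivisor {r : ℕ} {L : Fin r → CartierDivisor X} {x : X}
    {g : Fin r → (X.functionField)ˣ} (hg : ∀ i, IsLocalEquation (L i) x (g i)) (m : Fin r → ℤ) :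
    IsLocalEquation (multiDivisor L m) x (∏ i, g i ^ m i) := by
  unfold IsLocalEquation
  change germ x (∑ i, m i • L i) = _
  rw [map_sum, ofMul_prod, map_sum]
  exact Finset.sum_congr rfl fun i _ => (hg i).zsmul (m i)

lemma IsLocalEquation.mul_inv_mem {D : CartierDivisor X} {x : X} {g h : (X.functionField)ˣ}
    (hg : IsLocalEquation D x g) (hh : IsLocalEquation D x h) :
    (h : X.functionField) * (g : X.functionField)⁻¹ ∈ regularAt X x := by
  obtain ⟨v, hv⟩ := hg.exists_eq hh
  refine ⟨v, ?_⟩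
  rw [hv]
  field_simp [g.ne_zero]

lemma IsLocalEquation.of_mul_inv_mem {D : CartierDivisor X} {x : X} {g h : (X.functionField)ˣ}
    (hg : IsLocalEquation D x g) (h₁ : (h : X.functionField) * (g : X.functionField)⁻¹ ∈
      regularAt X x) (h₂ : (g : X.functionField) * (h : X.functionField)⁻¹ ∈ regularAt X x) :
    IsLocalEquation D x h := by
  obtain ⟨a, ha⟩ := h₁
  have hu : IsUnit a := by
    rw [isUnit_iff_inv_mem_regularAt, ha]
    refine ⟨mul_ne_zero h.ne_zero (inv_ne_zero g.ne_zero), ?_⟩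
    rwa [mul_inv, inv_inv, mul_comm]
  obtain ⟨v, rfl⟩ := hu
  have : h = g * Units.map (algebraMap (X.presheaf.stalk x) X.functionField).toMonoidHom v := by
    ext
    change (h : X.functionField) = g * algebraMap (X.presheaf.stalk x) X.functionField v
    rw [ha]
    field_simp [g.ne_zero]
  unfold IsLocalEquation at *
  rw [hg, this, ofMul_mul, map_add]
  refine (add_eq_left.2 ?_).symm
  exact (QuotientGroup.eq_one_iff _).2 ⟨v, rfl⟩

variable (k : Type u) [Field k] [X.Over (Spec (.of k))]

variable {k} in
lemma mul_mem_regularAt_of_mem_H0 {D : CartierDivisor X} {f : X.functionField} (hf : f ∈ H0 k D)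
    {x : X} {g : (X.functionField)ˣ} (hg : IsLocalEquation D x g) : f * g ∈ regularAt X x :=
  hf x g hg

/-- Local equations at a point differ by a unit of the local ring, so one of them is enough. -/
lemma mem_H0_of_exists {D : CartierDivisor X} {f : X.functionField}
    (h : ∀ x, ∃ g, IsLocalEquation D x g ∧ f * g ∈ regularAt X x) : f ∈ H0 k D := by
  intro x g hg
  obtain ⟨h, hh, hf⟩ := h x
  have := (regularAt X x).mul_mem hf (hh.mul_inv_mem hg)
  rwa [show f * h * (g * (h : X.functionField)⁻¹) = f * g by field_simp [h.ne_zero]] at this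

variable {k} in
lemma pow_mem_H0 {D : CartierDivisor X} {f : X.functionField} (hf : f ∈ H0 k D) (n : ℕ) :
    f ^ n ∈ H0 k (n • D) := by
  induction n with
  | zero => rw [pow_zero, zero_smul]; exact one_mem_H0 k
  | succ n ih => rw [pow_succ, succ_nsmul]; exact mul_mem_H0 k ih hf

lemma IsNonvanishingAt.mul {D E : CartierDivisor X} {f f' : X.functionField} {x : X}
    (h : IsNonvanishingAt D f x) (h' : IsNonvanishingAt E f' x) :
    IsNonvanishingAt (D + E) (f * f') x := by
  obtain ⟨hf, h⟩ := h
  obtain ⟨hf', h'⟩ := h'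
  refine ⟨mul_ne_zero hf hf', ?_⟩
  have := h.add h'
  rwa [← mul_inv, ← Units.mk0_mul] at this

lemma IsNonvanishingAt.pow {D : CartierDivisor X} {f : X.functionField} {x : X}
    (h : IsNonvanishingAt D f x) (n : ℕ) : IsNonvanishingAt (n • D) (f ^ n) x := by
  obtain ⟨hf, h⟩ := h
  refine ⟨pow_ne_zero n hf, ?_⟩
  have := h.nsmul n
  rwa [inv_pow, show Units.mk0 f hf ^ n = Units.mk0 (f ^ n) (pow_ne_zero n hf) from
    Units.ext rfl] at this

lemma IsNonvanishingAt.mul_inv_mem {D : CartierDivisor X} {f f' : X.functionField} {x : X}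
    (h : IsNonvanishingAt D f x) (hf' : f' ∈ H0 k D) : f' * f⁻¹ ∈ regularAt X x := by
  obtain ⟨hf, h⟩ := h
  have := mul_mem_regularAt_of_mem_H0 hf' h
  simpa using this

/-- A section does not vanish where it is the quotient of a nonvanishing section by a regular
function, up to a regular factor. -/
lemma isNonvanishingAt_iff {D : CartierDivisor X} {f : X.functionField} (hf : f ∈ H0 k D) {x : X}
    {g : (X.functionField)ˣ} (hg : IsLocalEquation D x g) :
    IsNonvanishingAt D f x ↔ f ≠ 0 ∧ (f * g)⁻¹ ∈ regularAt X x := by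
  constructor
  · rintro ⟨h0, h⟩
    refine ⟨h0, ?_⟩
    have := hg.mul_inv_mem h
    rwa [Units.val_inv_eq_inv_val, Units.val_mk0, ← mul_inv] at this
  · rintro ⟨h0, h⟩
    refine ⟨h0, hg.of_mul_inv_mem ?_ ?_⟩
    · rwa [Units.val_inv_eq_inv_val, Units.val_mk0, ← mul_inv]
    · rw [Units.val_inv_eq_inv_val, Units.val_mk0, inv_inv, mul_comm]
      exact mul_mem_regularAt_of_mem_H0 hf hg

/-- A factor of a unit is a unit: `(f d)⁻¹ = (f f' d e)⁻¹ (f' e)` is regular, and symmetrically. -/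
lemma isNonvanishingAt_mul_iff {D E : CartierDivisor X} {f f' : X.functionField} (hf : f ∈ H0 k D)
    (hf' : f' ∈ H0 k E) {x : X} :
    IsNonvanishingAt (D + E) (f * f') x ↔ IsNonvanishingAt D f x ∧ IsNonvanishingAt E f' x := by
  refine ⟨fun h => ?_, fun h => h.1.mul h.2⟩
  obtain ⟨d, hd⟩ := exists_isLocalEquation D x
  obtain ⟨e, he⟩ := exists_isLocalEquation E x
  rw [isNonvanishingAt_iff k (mul_mem_H0 k hf hf') (hd.add he)] at h
  obtain ⟨h0, h⟩ := h
  have h1 := left_ne_zero_of_mul h0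
  have h2 := right_ne_zero_of_mul h0
  have hd0 := d.ne_zero
  have he0 := e.ne_zero
  rw [isNonvanishingAt_iff k hf hd, isNonvanishingAt_iff k hf' he]
  refine ⟨⟨h1, ?_⟩, h2, ?_⟩
  · have := (regularAt X x).mul_mem h (mul_mem_regularAt_of_mem_H0 hf' he)
    rwa [show (f * f' * ((d * e : (X.functionField)ˣ) : X.functionField))⁻¹ * (f' * e) =
      (f * d)⁻¹ by rw [Units.val_mul]; field_simp] at this
  · have := (regularAt X x).mul_mem h (mul_mem_regularAt_of_mem_H0 hf hd)
    rwa [show (f * f' * ((d * e : (X.functionField)ˣ) : X.functionField))⁻¹ * (f * d) =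
      (f' * e)⁻¹ by rw [Units.val_mul]; field_simp] at this

end LocalEquations

end CoxQuotient

end
noncomputable section

namespace CoxQuotient

/-! ### Centers of valuation rings -/

section Center

lemma eq_toSpecΓ_comp {X : Scheme.{u}} {R : CommRingCat.{u}} (f : X ⟶ Spec R) :
    f = X.toSpecΓ ≫ Spec.map ((Scheme.ΓSpecIso R).inv ≫ f.appTop) := by
  rw [Spec.map_comp, ← Scheme.toSpecΓ_naturality_assoc, ← SpecMap_ΓSpecIso_hom,
    ← Spec.map_comp, Iso.inv_hom_id, Spec.map_id, Category.comp_id]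

variable {k : Type u} [Field k] {X : Scheme.{u}} [IsIntegral X] [X.Over (Spec (.of k))]

lemma fromSpecStalk_genericPoint_over :
    X.fromSpecStalk (genericPoint X) ≫ X ↘ Spec (.of k) =
      Spec.map (CommRingCat.ofHom (algebraMap k X.functionField)) := by
  rw [eq_toSpecΓ_comp (X ↘ Spec (.of k)), Scheme.fromSpecStalk_toSpecΓ_assoc, ← Spec.map_comp]
  rfl

/-- The center of a valuation ring of the function field on a proper scheme. -/
lemma exists_center [IsProper (X ↘ Spec (.of k))] (B : ValuationSubring X.functionField)
    (hk : ∀ c : k, algebraMap k X.functionField c ∈ B) :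
    ∃ x : X, ∀ f ∈ regularAt X x, f ∈ B := by
  have hcrit : ValuativeCriterion.Existence (X ↘ Spec (.of k)) := by
    have h : IsProper (X ↘ Spec (.of k)) := inferInstance
    rw [IsProper.eq_valuativeCriterion] at h
    exact ValuativeCriterion.existence h.1.1.1
  let j : k →+* B := (algebraMap k X.functionField).codRestrict B hk
  have hsq : X.fromSpecStalk (genericPoint X) ≫ X ↘ Spec (.of k) =
      Spec.map (CommRingCat.ofHom (algebraMap B X.functionField)) ≫
        Spec.map (CommRingCat.ofHom j) := by
    rw [fromSpecStalk_genericPoint_over, ← Spec.map_comp]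
    rfl
  -- The valuative criterion extends the generic point to `Spec B → X`. The center is the image of
  -- the closed point.
  obtain ⟨l, hl, -⟩ := (hcrit { R := B, K := X.functionField, commSq := ⟨hsq⟩, .. }).exists_lift
  dsimp only at hl
  refine ⟨l (IsLocalRing.closedPoint B), ?_⟩
  let φ := Scheme.stalkClosedPointTo (R := .of B) l
  have hφ : Spec.map φ ≫ X.fromSpecStalk _ = l :=
    Scheme.Spec_stalkClosedPointTo_fromSpecStalk (R := .of B) l
  have hη := Scheme.SpecMap_stalkSpecializes_fromSpecStalk
    ((genericPoint_spec X).specializes (Set.mem_univ (l (IsLocalRing.closedPoint (B : Type u)))))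
  have hl' : Spec.map (CommRingCat.ofHom (algebraMap B X.functionField)) ≫ l =
    X.fromSpecStalk (genericPoint X) := hl
  rw [← hφ] at hl'
  have hl := (Category.assoc _ _ _).trans (hl'.trans hη.symm)
  -- `Spec` of a local ring of `X` is a monomorphism into `X`, so the map from the local ring to `B`
  -- becomes the inclusion into the function field.
  rw [cancel_mono, ← Spec.map_comp] at hl
  have h := Spec.map_injective hl
  rintro _ ⟨a, rfl⟩
  have := congrArg (fun ψ => ψ.hom a) h
  refine Eq.subst (motive := fun z => z ∈ B) this (Subtype.mem _)

end Center

/-! ### Extending sections from a nonvanishing locus -/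

section Extension

variable (k : Type u) [Field k] {X : Scheme.{u}} [IsIntegral X] [X.Over (Spec (.of k))]

lemma exists_isLocalEquation_affine (D : CartierDivisor X) (W : X.Opens) {x : X} (hx : x ∈ W) :
    ∃ V : X.Opens, IsAffineOpen V ∧ x ∈ V ∧ V ≤ W ∧ ∃ g, ∀ y ∈ V, IsLocalEquation D y g := by
  obtain ⟨U, hU, g, hg⟩ := exists_isLocalEquation_nhds D x
  obtain ⟨_, ⟨V, hV, rfl⟩, hxV, hVU⟩ :=
    X.isBasis_affineOpens.exists_subset_of_mem_open (show x ∈ U ⊓ W from ⟨hU, hx⟩) (U ⊓ W).isOpen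
  exact ⟨V, hV, hxV, fun y hy => (hVU hy).2, g, fun y hy => hg y (hVU hy).1⟩

/-- A section of `𝒪(E)` over the nonvanishing locus of a section `s` of `𝒪(D)` extends to `X` after
multiplication by a power of `s`. -/
lemma exists_mul_pow_mem_H0 [CompactSpace X] {D E : CartierDivisor X} {s : X.functionField}
    (hs : s ∈ H0 k D) (hs0 : s ≠ 0) (f : X.functionField)
    (hf : ∀ x, IsNonvanishingAt D s x → ∀ g, IsLocalEquation E x g → f * g ∈ regularAt X x) :
    ∃ N₀ : ℕ, ∀ N ≥ N₀, f * s ^ N ∈ H0 k (E + N • D) := by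
  have hloc : ∀ x : X, ∃ V : X.Opens, x ∈ V ∧ ∃ N₀ : ℕ, ∀ N ≥ N₀, ∀ y ∈ V,
      ∃ g, IsLocalEquation (E + N • D) y g ∧ f * s ^ N * g ∈ regularAt X y := by
    intro x
    obtain ⟨V', -, hxV', -, d, hd⟩ := exists_isLocalEquation_affine D ⊤ (Opens.mem_top x)
    obtain ⟨V, hV, hxV, hVV', e, he⟩ := exists_isLocalEquation_affine E V' hxV'
    have hη : genericPoint X ∈ V := genericPoint_mem hxV
    -- Locally `s` is the regular function `σ = s d`, and its nonvanishing locus in `V` is `D(σ)`.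
    obtain ⟨σ, hσ⟩ := exists_toFunctionField_eq hV hη (s * d) fun y hy =>
      mul_mem_regularAt_of_mem_H0 hs (hd y (hVV' hy))
    obtain ⟨N₀, a, ha⟩ := exists_pow_mul_eq_toFunctionField hV hη σ (f * e) (by
      intro y hy hu
      refine hf y ?_ e (he y hy)
      rw [isNonvanishingAt_iff k hs (hd y (hVV' hy))]
      rw [isUnit_iff_inv_mem_regularAt, algebraMap_germ hy hη, hσ] at hu
      exact ⟨hs0, hu.2⟩)
    refine ⟨V, hxV, N₀, fun N hN y hy =>
      ⟨e * d ^ N, (he y hy).add ((hd y (hVV' hy)).nsmul N), ?_⟩⟩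
    have h1 : f * s ^ N * ((e * d ^ N : (X.functionField)ˣ) : X.functionField) =
        toFunctionField V hη (a * σ ^ (N - N₀)) := by
      obtain ⟨M, rfl⟩ := Nat.exists_eq_add_of_le hN
      rw [map_mul, ha, map_pow, hσ, Nat.add_sub_cancel_left, Units.val_mul, Units.val_pow_eq_pow_val]
      ring
    rw [h1]
    exact toFunctionField_mem_regularAt hy hη _
  choose V hxV N₀ hN₀ using hloc
  obtain ⟨t, ht⟩ := isCompact_univ.elim_finite_subcover (fun x => (V x : Set X))
    (fun x => (V x).isOpen) fun x _ => Set.mem_iUnion.2 ⟨x, hxV x⟩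
  -- The local bounds hold for all larger exponents, so the maximum over a finite subcover works
  -- everywhere.
  refine ⟨t.sup N₀, fun N hN => mem_H0_of_exists k fun y => ?_⟩
  obtain ⟨x, hx, hy⟩ := Set.mem_iUnion₂.1 (ht (Set.mem_univ y))
  exact hN₀ x N ((Finset.le_sup hx).trans hN) y hy

end Extension

/-! ### Invariance of ampleness under linear equivalence -/

section LinearEquivalence

variable (k : Type u) [Field k] {X : Scheme.{u}} [IsIntegral X] [X.Over (Spec (.of k))]

/-- Multiplication by `h` carries `𝒪(D + div h)` to `𝒪(D)`; the next lemma says that it preserves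
nonvanishing loci. -/
lemma mul_mem_H0_of_principal {D : CartierDivisor X} {h : (X.functionField)ˣ} {f : X.functionField}
    (hf : f ∈ H0 k (D + principalDivisor X (Additive.ofMul h))) : f * h ∈ H0 k D := by
  intro x g hg
  have := mul_mem_regularAt_of_mem_H0 hf (hg.add (isLocalEquation_principalDivisor x h))
  rwa [Units.val_mul, mul_comm (g : X.functionField), ← mul_assoc] at this

lemma isNonvanishingAt_mul_of_principal {D : CartierDivisor X} {h : (X.functionField)ˣ}
    {f : X.functionField} {x : X} :
    IsNonvanishingAt D (f * h) x ↔
      IsNonvanishingAt (D + principalDivisor X (Additive.ofMul h)) f x := by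
  have key : ∀ (hf : f ≠ 0), IsLocalEquation D x (Units.mk0 (f * h) (mul_ne_zero hf h.ne_zero))⁻¹ ↔
      IsLocalEquation (D + principalDivisor X (Additive.ofMul h)) x (Units.mk0 f hf)⁻¹ := by
    intro hf
    have e : (Units.mk0 (f * h) (mul_ne_zero hf h.ne_zero))⁻¹ * h = (Units.mk0 f hf)⁻¹ := by
      rw [Units.mk0_mul, mul_inv, Units.mk0_val, inv_mul_cancel_right]
    rw [← e]
    unfold IsLocalEquation
    rw [map_add, ofMul_mul, map_add]
    exact (add_left_inj _).symm
  constructor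
  · rintro ⟨h0, hl⟩
    exact ⟨left_ne_zero_of_mul h0, (key _).1 hl⟩
  · rintro ⟨h0, hl⟩
    exact ⟨mul_ne_zero h0 h.ne_zero, (key _).2 hl⟩

lemma IsAmple.of_toPic_eq {D A : CartierDivisor X} (hA : IsAmple k A) (h : toPic D = toPic A) :
    IsAmple k D := by
  obtain ⟨g, hg⟩ := QuotientAddGroup.eq.1 h
  have hDA : A = D + principalDivisor X g := by
    change principalDivisor X g = _ at hg
    rw [hg]; abel
  refine ⟨hA.compact, fun x => ?_⟩
  obtain ⟨n, hn, s, hs, U, hU, hxU, hUs⟩ := hA.exists_section x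
  have e : n • A = n • D + principalDivisor X (Additive.ofMul (g.toMul ^ n)) := by
    rw [hDA, smul_add, ← map_nsmul]; rfl
  rw [e] at hs hUs
  exact ⟨n, hn, _, mul_mem_H0_of_principal k hs, U, hU, hxU, fun y =>
    (hUs y).trans (isNonvanishingAt_mul_of_principal).symm⟩

end LinearEquivalence

end CoxQuotient

end
noncomputable section

namespace CoxQuotient

/-! ### Charts and the covering of the semistable locus -/

section Charts

variable (k : Type u) [Field k] {X : Scheme.{u}} [IsIntegral X] [X.Over (Spec (.of k))] {r : ℕ}
  (L : Fin r → CartierDivisor X)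

variable {L} in
/-- The homogeneous element of degree `m` given by a rational function in `H⁰(X, ∑ mᵢLᵢ)`. -/
def coxMk (m : Fin r → ℤ) (f : X.functionField) (hf : f ∈ coxPiece k L m) : Cox k L :=
  coxOf k L m ⟨f, hf⟩

variable {k L}

lemma coxMk_congr {m m' : Fin r → ℤ} {f f' : X.functionField} {hf : f ∈ coxPiece k L m}
    {hf' : f' ∈ coxPiece k L m'} (hm : m = m') (h : f = f') : coxMk k m f hf = coxMk k m' f' hf' := by
  subst hm h; rfl

lemma mul_mem_coxPiece {m m' : Fin r → ℤ} {f f' : X.functionField} (hf : f ∈ coxPiece k L m)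
    (hf' : f' ∈ coxPiece k L m') : f * f' ∈ coxPiece k L (m + m') :=
  SetLike.GradedMul.mul_mem hf hf'

lemma pow_mem_coxPiece {m : Fin r → ℤ} {f : X.functionField} (hf : f ∈ coxPiece k L m) (n : ℕ) :
    f ^ n ∈ coxPiece k L (n • m) :=
  SetLike.pow_mem_graded n hf

lemma coxMk_mul_coxMk {m m' : Fin r → ℤ} {f f' : X.functionField} (hf : f ∈ coxPiece k L m)
    (hf' : f' ∈ coxPiece k L m') :
    coxMk k m f hf * coxMk k m' f' hf' = coxMk k (m + m') (f * f') (mul_mem_coxPiece hf hf') :=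
  DirectSum.of_mul_of (A := fun m => coxPiece k L m) _ _

lemma coxMk_pow {m : Fin r → ℤ} {f : X.functionField} (hf : f ∈ coxPiece k L m) (n : ℕ) :
    coxMk k m f hf ^ n = coxMk k (n • m) (f ^ n) (pow_mem_coxPiece hf n) :=
  DirectSum.ofPow (A := fun m => coxPiece k L m) _ _

lemma coxMk_add {m : Fin r → ℤ} {f f' : X.functionField} (hf : f ∈ coxPiece k L m)
    (hf' : f' ∈ coxPiece k L m) :
    coxMk k m f hf + coxMk k m f' hf' = coxMk k m (f + f') (add_mem hf hf') :=
  (map_add (coxOf k L m) ⟨f, hf⟩ ⟨f', hf'⟩).symm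

variable (k L) in
/-- A nonzero section `s` of a positive multiple of `∑ aᵢLᵢ` with affine nonvanishing locus `U` over
which all the line bundles `𝒪(Lᵢ)` are trivial. -/
structure Chart (a : Fin r → ℤ) where
  n : ℕ
  n_pos : 0 < n
  s : X.functionField
  s_mem : s ∈ coxPiece k L (n • a)
  s_ne_zero : s ≠ 0
  U : X.Opens
  affine : IsAffineOpen U
  generic_mem : genericPoint X ∈ U
  mem_U : ∀ y, y ∈ U ↔ IsNonvanishingAt (multiDivisor L (n • a)) s y
  g : Fin r → (X.functionField)ˣ
  isLocalEquation_g : ∀ i, ∀ y ∈ U, IsLocalEquation (L i) y (g i)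

/-- Ampleness gives a section `s` with affine nonvanishing locus around `x`. Shrink this locus to a
basic open set `D(φ)` on which all `Lᵢ` are trivial, and clear the poles of `φ` with a power of `s`.
-/
lemma exists_chart_mem {a : Fin r → ℤ} (hA : IsAmple k (multiDivisor L a)) (x : X) :
    ∃ c : Chart k L a, x ∈ c.U := by
  have := hA.compact
  obtain ⟨n, hn, s, hs, U, hU, hxU, hUs⟩ := hA.exists_section x
  have hs0 : s ≠ 0 := ((hUs x).1 hxU).1
  choose W hxW g hg using fun i => exists_isLocalEquation_nhds (L i) x
  obtain ⟨φ, hφW, hxφ⟩ := hU.exists_basicOpen_le (V := ⟨⋂ i, (W i : Set X),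
    isOpen_iInter_of_finite fun i => (W i).isOpen⟩) ⟨x, Set.mem_iInter.2 hxW⟩ hxU
  have hφη : genericPoint X ∈ X.basicOpen φ := genericPoint_mem hxφ
  have hη : genericPoint X ∈ U := X.basicOpen_le φ hφη
  have hunit : ∀ y (hy : y ∈ U), y ∈ X.basicOpen φ ↔
      toFunctionField U hη φ ≠ 0 ∧ (toFunctionField U hη φ)⁻¹ ∈ regularAt X y := by
    intro y hy
    rw [Scheme.mem_basicOpen _ _ _ hy, isUnit_iff_inv_mem_regularAt, algebraMap_germ hy hη]
  have hφ0 : toFunctionField U hη φ ≠ 0 := ((hunit _ hη).1 hφη).1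
  obtain ⟨N, hN⟩ := exists_mul_pow_mem_H0 k (E := 0) hs hs0 (toFunctionField U hη φ) (by
    intro y hy g hg
    have := hg.mul_inv_mem (isLocalEquation_zero_one y)
    obtain ⟨v, hv⟩ := (isLocalEquation_zero_one y).exists_eq hg
    refine (regularAt X y).mul_mem (toFunctionField_mem_regularAt ((hUs y).2 hy) hη φ) ⟨v, ?_⟩
    rw [hv, Units.val_one, one_mul])
  have h1 := hN N le_rfl
  rw [zero_add] at h1
  have hD : multiDivisor L (((N + 1) * n) • a) =
      N • n • multiDivisor L a + n • multiDivisor L a := by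
    rw [map_nsmul, mul_smul, succ_nsmul]
  -- The extra factor `s` makes the section vanish outside `U`, where nothing is known about `φ
  -- s^N`; it also keeps the degree positive.
  refine ⟨⟨(N + 1) * n, by positivity, toFunctionField U hη φ * s ^ N * s, ?_,
    mul_ne_zero (mul_ne_zero hφ0 (pow_ne_zero _ hs0)) hs0, X.basicOpen φ, hU.basicOpen φ, hφη,
    ?_, g, fun i y hy => hg i y (Set.mem_iInter.1 (hφW hy) i)⟩, hxφ⟩
  · unfold coxPiece
    rw [hD]
    exact mul_mem_H0 k h1 hs
  · intro y
    rw [hD, isNonvanishingAt_mul_iff k h1 hs, ← hUs]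
    constructor
    · intro hy
      have hyU := X.basicOpen_le φ hy
      refine ⟨?_, hyU⟩
      obtain ⟨hsN, hl⟩ := ((hUs y).1 hyU).pow N
      rw [isNonvanishingAt_iff k h1 hl, Units.val_inv_eq_inv_val, Units.val_mk0,
        mul_inv_cancel_right₀ hsN]
      exact ⟨mul_ne_zero hφ0 hsN, ((hunit y hyU).1 hy).2⟩
    · rintro ⟨hy, hyU⟩
      rw [hunit y hyU]
      obtain ⟨hsN, hl⟩ := ((hUs y).1 hyU).pow N
      rw [isNonvanishingAt_iff k h1 hl, Units.val_inv_eq_inv_val, Units.val_mk0,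
        mul_inv_cancel_right₀ hsN] at hy
      exact ⟨hφ0, hy.2⟩

namespace Chart

variable {a : Fin r → ℤ} (c c' : Chart k L a)

/-- The element of the Cox ring given by the section of a chart. -/
def elem : Cox k L := coxMk k (c.n • a) c.s c.s_mem

/-- The product of the powers of the local equations: a local equation of `∑ mᵢLᵢ`. -/
def gpow (m : Fin r → ℤ) : (X.functionField)ˣ := ∏ i, c.g i ^ m i

lemma gpow_add (m m' : Fin r → ℤ) : c.gpow (m + m') = c.gpow m * c.gpow m' := by
  unfold gpow
  rw [← Finset.prod_mul_distrib]
  exact Finset.prod_congr rfl fun i _ => zpow_add _ _ _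

lemma gpow_zero : c.gpow 0 = 1 := Finset.prod_eq_one fun _ _ => zpow_zero _

lemma gpow_neg (m : Fin r → ℤ) : c.gpow (-m) = (c.gpow m)⁻¹ := by
  rw [eq_inv_iff_mul_eq_one, ← gpow_add, neg_add_cancel, gpow_zero]

lemma isLocalEquation_gpow (m : Fin r → ℤ) {y : X} (hy : y ∈ c.U) :
    IsLocalEquation (multiDivisor L m) y (c.gpow m) :=
  isLocalEquation_multiDivisor (fun i => c.isLocalEquation_g i y hy) m

lemma mem_coxPiece_cross {n n' : ℕ} {f : X.functionField} (hf : f ∈ coxPiece k L (n • a)) :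
    f ^ n' ∈ coxPiece k L ((n * n') • a) := by
  have := pow_mem_coxPiece hf n'
  rwa [smul_smul, mul_comm] at this

/-- Numerator and denominator are sections of the same divisor, and the denominator does not vanish
on `c.U`. -/
lemma pow_mul_inv_mem {n : ℕ} {f : X.functionField} (hf : f ∈ coxPiece k L (n • a)) {x : X}
    (hx : x ∈ c.U) : f ^ c.n * (c.s ^ n)⁻¹ ∈ regularAt X x := by
  have h := ((c.mem_U x).1 hx).pow n
  rw [← map_nsmul, smul_smul] at h
  exact h.mul_inv_mem k (mem_coxPiece_cross hf)

/-- The ratio of two charts, a regular function on the first one, cuts out their intersection. -/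
lemma exists_ratio : ∃ e : Γ(X, c.U),
    toFunctionField c.U c.generic_mem e = c'.s ^ c.n * (c.s ^ c'.n)⁻¹ ∧
      X.basicOpen e = c.U ⊓ c'.U := by
  obtain ⟨e, he⟩ := exists_toFunctionField_eq c.affine c.generic_mem _
    fun x hx => c.pow_mul_inv_mem c'.s_mem hx
  refine ⟨e, he, ?_⟩
  ext y
  by_cases hy : y ∈ c.U
  · change y ∈ X.basicOpen e ↔ y ∈ c.U ∧ y ∈ c'.U
    rw [Scheme.mem_basicOpen _ _ _ hy, isUnit_iff_inv_mem_regularAt,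
      algebraMap_germ hy c.generic_mem, he]
    have h0 : c'.s ^ c.n * (c.s ^ c'.n)⁻¹ ≠ 0 :=
      mul_ne_zero (pow_ne_zero _ c'.s_ne_zero) (inv_ne_zero (pow_ne_zero _ c.s_ne_zero))
    have hinv : (c'.s ^ c.n * (c.s ^ c'.n)⁻¹)⁻¹ = c.s ^ c'.n * (c'.s ^ c.n)⁻¹ := by
      rw [mul_inv, inv_inv, mul_comm]
    rw [hinv]
    constructor
    · rintro ⟨-, h⟩
      refine ⟨hy, ?_⟩
      obtain ⟨hne, hl⟩ := ((c.mem_U y).1 hy).pow c'.n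
      have hmem := pow_mem_H0 c'.s_mem c.n
      rw [← map_nsmul, smul_smul, mul_comm, ← smul_smul, map_nsmul] at hl
      have hnv : IsNonvanishingAt (c.n • multiDivisor L (c'.n • a)) (c'.s ^ c.n) y := by
        rw [isNonvanishingAt_iff k hmem hl, Units.val_inv_eq_inv_val, Units.val_mk0, hinv]
        exact ⟨pow_ne_zero _ c'.s_ne_zero, h⟩
      rw [c'.mem_U]
      -- Nonvanishing of the power gives nonvanishing of `c'.s` only because the exponent `c.n` is
      -- positive.
      obtain ⟨m, hm⟩ := Nat.exists_eq_succ_of_ne_zero c.n_pos.ne'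
      rw [hm, Nat.succ_eq_add_one, succ_nsmul, pow_succ,
        isNonvanishingAt_mul_iff k (pow_mem_H0 c'.s_mem m) c'.s_mem] at hnv
      exact hnv.2
    · rintro ⟨-, hy'⟩
      exact ⟨h0, c'.pow_mul_inv_mem c.s_mem hy'⟩
  · exact ⟨fun h => (hy (X.basicOpen_le e h)).elim, fun h => (hy h.1).elim⟩

/-- The product of two charts. -/
def mul : Chart k L a where
  n := c.n + c'.n
  n_pos := Nat.add_pos_left c.n_pos _
  s := c.s * c'.s
  s_mem := by rw [add_smul]; exact mul_mem_coxPiece c.s_mem c'.s_mem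
  s_ne_zero := mul_ne_zero c.s_ne_zero c'.s_ne_zero
  U := c.U ⊓ c'.U
  affine := by
    obtain ⟨e, -, he⟩ := c.exists_ratio c'
    rw [← he]
    exact c.affine.basicOpen e
  generic_mem := ⟨c.generic_mem, c'.generic_mem⟩
  mem_U y := by
    rw [add_smul, map_add, isNonvanishingAt_mul_iff k c.s_mem c'.s_mem, ← c.mem_U, ← c'.mem_U]
    rfl
  g := c.g
  isLocalEquation_g i y hy := c.isLocalEquation_g i y hy.1

lemma elem_mul : (c.mul c').elem = c.elem * c'.elem := by
  unfold elem
  rw [coxMk_mul_coxMk]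
  exact coxMk_congr (add_smul _ _ _) rfl

end Chart

/-- On a proper scheme the charts cover the complement of the irrelevant locus. -/
lemma exists_chart_notMem [IsProper (X ↘ Spec (.of k))] {a : Fin r → ℤ}
    (hcov : ∀ x : X, ∃ c : Chart k L a, x ∈ c.U) (P : Ideal (Cox k L)) (hP : P.IsPrime)
    {n : ℕ} (hn : 0 < n) {s : X.functionField} (hs : s ∈ coxPiece k L (n • a))
    (hsP : coxMk k (n • a) s hs ∉ P) : ∃ c : Chart k L a, c.elem ∉ P := by
  by_contra! hall
  have hs0 : s ≠ 0 := by
    rintro rfl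
    exact hsP ((congrArg (· ∈ P) (map_zero (coxOf k L (n • a)))).mpr P.zero_mem)
  -- The degree zero part of `Cox[1/s]`, as a ring of rational functions.
  let A₀ : Subring X.functionField :=
    { carrier := {x | ∃ N : ℕ, x * s ^ N ∈ coxPiece k L (N • n • a)}
      zero_mem' := ⟨0, by simp⟩
      one_mem' := ⟨0, by simpa using SetLike.GradedOne.one_mem⟩
      add_mem' := by
        rintro x y ⟨N, hN⟩ ⟨M, hM⟩
        refine ⟨N + M, ?_⟩
        have h1 := mul_mem_coxPiece hN (pow_mem_coxPiece hs M)
        have h2 := mul_mem_coxPiece (pow_mem_coxPiece hs N) hM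
        rw [← add_smul] at h1 h2
        convert add_mem h1 h2 using 1
        ring
      neg_mem' := by
        rintro x ⟨N, hN⟩
        exact ⟨N, by rw [neg_mul]; exact neg_mem hN⟩
      mul_mem' := by
        rintro x y ⟨N, hN⟩ ⟨M, hM⟩
        refine ⟨N + M, ?_⟩
        have h1 := mul_mem_coxPiece hN hM
        rw [← add_smul] at h1
        convert h1 using 1
        ring }
  -- The degree zero part of the extension of `P` to `Cox[1/s]`; it is proper since no power of `s`
  -- lies in `P`.
  let I : Ideal A₀ :=
    { carrier := {x | ∃ (N : ℕ) (h : (x : X.functionField) * s ^ N ∈ coxPiece k L (N • n • a)),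
        coxMk k _ _ h ∈ P}
      zero_mem' := ⟨0, by simp, by
        refine (congrArg (· ∈ P) ?_).mpr P.zero_mem
        exact (coxMk_congr (hf' := zero_mem _) rfl (by simp)).trans
          (map_zero (coxOf k L (0 • n • a)))⟩
      add_mem' := by
        rintro x y ⟨N, hN, hNP⟩ ⟨M, hM, hMP⟩
        have h1 := mul_mem_coxPiece hN (pow_mem_coxPiece hs M)
        have h2 := mul_mem_coxPiece (pow_mem_coxPiece hs N) hM
        have h3 : coxMk k _ _ (add_mem h1 h2) ∈ P := by
          rw [← coxMk_add h1 h2, ← coxMk_mul_coxMk hN (pow_mem_coxPiece hs M)]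
          refine P.add_mem (P.mul_mem_right _ hNP) ?_
          have : coxMk k _ _ h2 ∈ P := by
            rw [← coxMk_mul_coxMk (pow_mem_coxPiece hs N) hM]
            exact P.mul_mem_left _ hMP
          exact this
        have e : (x : X.functionField) * s ^ N * s ^ M + s ^ N * (y * s ^ M) =
          ((x + y : A₀) : X.functionField) * s ^ (N + M) := by
          rw [Subring.coe_add]; ring
        refine ⟨N + M, ?_, ?_⟩
        · rw [← add_smul] at h1 h2
          rw [← e]
          exact add_mem h1 h2
        · rw [coxMk_congr (add_smul _ _ _) e.symm]
          exact h3
      smul_mem' := by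
        rintro ⟨x, M, hM⟩ y ⟨N, hN, hNP⟩
        have h1 := mul_mem_coxPiece hM hN
        have e : x * s ^ M * (y * s ^ N) = x * (y : X.functionField) * s ^ (M + N) := by ring
        refine ⟨M + N, ?_, ?_⟩
        · rw [← add_smul] at h1
          change x * (y : X.functionField) * s ^ (M + N) ∈ _
          rwa [← e]
        · have h3 : coxMk k _ _ h1 ∈ P := by
            rw [← coxMk_mul_coxMk hM hN]
            exact P.mul_mem_left _ hNP
          exact (congrArg (· ∈ P) (coxMk_congr (add_smul _ _ _) e.symm)).mpr h3 }
  have hI : I ≠ ⊤ := by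
    rw [Ideal.ne_top_iff_one]
    rintro ⟨N, hN, hNP⟩
    refine hsP (hP.mem_of_pow_mem N ?_)
    rw [coxMk_pow]
    rwa [coxMk_congr rfl (show ((1 : A₀) : X.functionField) * s ^ N = s ^ N from one_mul _)] at hNP
  -- A valuation ring containing `A₀` whose maximal ideal contains `I`. It contains the constants,
  -- so it has a center `x` on `X`.
  obtain ⟨B, hAB, hIB⟩ := Ideal.image_subset_nonunits_valuationSubring I hI
  obtain ⟨x, hx⟩ := exists_center (k := k) B fun t => hAB ⟨0, by
    rw [pow_zero, mul_one, zero_smul, Algebra.algebraMap_eq_smul_one]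
    exact Submodule.smul_mem _ _ SetLike.GradedOne.one_mem⟩
  obtain ⟨c, hc⟩ := hcov x
  -- For a chart `c` around the center, `s^{c.n} / c.s^n` is regular at `x` and so lies in `B`. Its
  -- inverse lies in `I`, because `c.elem ∈ P` and `n > 0`, and is therefore a nonunit of `B`: a
  -- contradiction.
  have h1 := hx _ (c.pow_mul_inv_mem hs hc)
  have hmem : c.s ^ n * (s ^ c.n)⁻¹ * s ^ c.n = c.s ^ n := by
    rw [inv_mul_cancel_right₀ (pow_ne_zero _ hs0)]
  have hdeg : n • c.n • a = c.n • n • a := smul_comm _ _ _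
  have hmem' : c.s ^ n * (s ^ c.n)⁻¹ * s ^ c.n ∈ coxPiece k L (c.n • n • a) := by
    rw [hmem, ← hdeg]
    exact pow_mem_coxPiece c.s_mem n
  have h2 : c.s ^ n * (s ^ c.n)⁻¹ ∈ B.nonunits := by
    refine hIB ⟨⟨_, c.n, hmem'⟩, ⟨c.n, hmem', ?_⟩, rfl⟩
    rw [coxMk_congr (hf' := pow_mem_coxPiece c.s_mem n) hdeg.symm hmem, ← coxMk_pow c.s_mem n]
    exact P.pow_mem_of_mem (hall c) _ hn
  rw [ValuationSubring.mem_nonunits_iff_or] at h2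
  rcases h2 with h2 | h2
  · exact mul_ne_zero (pow_ne_zero _ c.s_ne_zero) (inv_ne_zero (pow_ne_zero _ hs0)) h2
  · rw [mul_inv, inv_inv, mul_comm] at h2
    exact h2 h1

end Charts

end CoxQuotient

end
noncomputable section

namespace CoxQuotient

/-! ### The Cox ring inside the Laurent polynomial ring over the function field -/

section LaurentRing

variable {A B C : Type*} [CommRing A] [CommRing B] [CommRing C]

/-- The factorization of a homomorphism of algebras through an injective one. -/
def liftOfInjective {k : Type*} [CommRing k] [Algebra k A] [Algebra k B] [Algebra k C]
    (i : B →ₐ[k] C) (hi : Function.Injective i) (f : A →ₐ[k] C) (h : ∀ a, f a ∈ i.range) :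
    A →ₐ[k] B :=
  (AlgEquiv.ofInjective i hi).symm.toAlgHom.comp (f.codRestrict i.range h)

lemma apply_liftOfInjective {k : Type*} [CommRing k] [Algebra k A] [Algebra k B] [Algebra k C]
    (i : B →ₐ[k] C) (hi : Function.Injective i) (f : A →ₐ[k] C) (h : ∀ a, f a ∈ i.range) (a : A) :
    i (liftOfInjective i hi f h a) = f a :=
  congrArg Subtype.val ((AlgEquiv.ofInjective i hi).apply_symm_apply (f.codRestrict i.range h a))

variable (k : Type u) [Field k] {X : Scheme.{u}} [IsIntegral X] [X.Over (Spec (.of k))] {r : ℕ}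
  (L : Fin r → CartierDivisor X)

/-- The embedding of the Cox ring in the Laurent polynomial ring over the function field. -/
def coxToLaurent : Cox k L →ₐ[k] AddMonoidAlgebra X.functionField (Fin r → ℤ) :=
  DirectSum.toAlgebra k (fun m => coxPiece k L m)
    (fun m => (AddMonoidAlgebra.lsingle (R := k) m).comp (coxPiece k L m).subtype)
    rfl
    (by
      intro m n x y
      exact (AddMonoidAlgebra.single_mul_single ..).symm)

variable {k L}

lemma coxToLaurent_coxMk (m : Fin r → ℤ) (f : X.functionField) (hf : f ∈ coxPiece k L m) :
    coxToLaurent k L (coxMk k m f hf) = AddMonoidAlgebra.single m f :=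
  DirectSum.toAddMonoid_of
    (fun m => ((AddMonoidAlgebra.lsingle (R := k) m).comp
      (coxPiece k L m).subtype : coxPiece k L m →ₗ[k]
        AddMonoidAlgebra X.functionField (Fin r → ℤ)).toAddMonoidHom) m ⟨f, hf⟩

lemma coxMk_induction {P : Cox k L → Prop} (c : Cox k L) (zero : P 0)
    (of : ∀ m f hf, P (coxMk k m f hf)) (add : ∀ x y, P x → P y → P (x + y)) : P c :=
  cox_induction k L c zero (fun m s => of m s.1 s.2) add

lemma coxToLaurent_apply (x : Cox k L) (m : Fin r → ℤ) :
    (coxToLaurent k L x).coeff m = ((show ⨁ m : Fin r → ℤ, coxPiece k L m from x) m : X.functionField) := by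
  induction x using cox_induction with
  | zero => rw [map_zero]; rfl
  | of m' s =>
    refine (congrArg (fun q => q.coeff m) (coxToLaurent_coxMk m' s.1 s.2)).trans ?_
    by_cases h : m' = m
    · subst h
      refine (Finsupp.single_eq_same ..).trans ?_
      exact congrArg Subtype.val (DirectSum.of_eq_same (β := fun m => coxPiece k L m) m' s).symm
    · refine (Finsupp.single_eq_of_ne (Ne.symm h)).trans ?_
      exact congrArg Subtype.val
        (DirectSum.of_eq_of_ne (β := fun m => coxPiece k L m) m' m s (Ne.symm h)).symm
  | add x y hx hy =>
    rw [map_add]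
    refine (congrArg₂ (· + ·) hx hy).trans ?_
    rfl

lemma coxToLaurent_injective : Function.Injective (coxToLaurent k L) := by
  rw [injective_iff_map_eq_zero]
  intro x hx
  refine DFinsupp.ext fun m => Subtype.ext ?_
  exact (coxToLaurent_apply x m).symm.trans (by rw [hx]; rfl)

end LaurentRing

/-! ### The localization at a chart: projection, section and torus coordinates -/

section ChartRings

variable {k : Type u} [Field k] {X : Scheme.{u}} [IsIntegral X] [X.Over (Spec (.of k))] {r : ℕ}
  {L : Fin r → CartierDivisor X} {a : Fin r → ℤ}

namespace Chart

variable (c : Chart k L a)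

/-- The ring of functions on the base of a chart. -/
def BaseRing : Type u := Γ(X, c.U)

instance : CommRing c.BaseRing := inferInstanceAs (CommRing Γ(X, c.U))

instance : Algebra k c.BaseRing :=
  ((X.presheaf.map (homOfLE le_top : c.U ⟶ ⊤).op).hom.comp (constants k X)).toAlgebra

/-- Functions on the base of a chart as rational functions. -/
def baseToField : c.BaseRing →ₐ[k] X.functionField where
  toRingHom := toFunctionField c.U c.generic_mem
  commutes' t := toFunctionField_res (U := ⊤) le_top c.generic_mem (constants k X t)

lemma baseToField_injective : Function.Injective c.baseToField :=
  toFunctionField_injective c.U c.generic_mem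

lemma exists_baseToField_eq {f : X.functionField} (hf : ∀ x ∈ c.U, f ∈ regularAt X x) :
    ∃ b, c.baseToField b = f :=
  exists_toFunctionField_eq c.affine c.generic_mem f hf

lemma baseToField_mem_regularAt (b : c.BaseRing) {x : X} (hx : x ∈ c.U) :
    c.baseToField b ∈ regularAt X x :=
  toFunctionField_mem_regularAt hx c.generic_mem b

/-- The localization of the Cox ring at the section of a chart. -/
abbrev TotalRing : Type u := Localization.Away c.elem

/-- The localization homomorphism. -/
def toTotal : Cox k L →ₐ[k] c.TotalRing := IsScalarTower.toAlgHom k (Cox k L) c.TotalRing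

lemma isUnit_toTotal_elem : IsUnit (c.toTotal c.elem) :=
  IsLocalization.Away.algebraMap_isUnit c.elem

/-- The homomorphism from the localization at the section of a chart given by a homomorphism that
inverts the section. -/
def liftTotal {B : Type*} [CommRing B] [Algebra k B] (f : Cox k L →ₐ[k] B)
    (hf : IsUnit (f c.elem)) : c.TotalRing →ₐ[k] B :=
  IsLocalization.liftAlgHom (M := Submonoid.powers c.elem) (f := f) (by
    rintro ⟨_, n, rfl⟩
    rw [map_pow]
    exact hf.pow n)

lemma liftTotal_toTotal {B : Type*} [CommRing B] [Algebra k B] (f : Cox k L →ₐ[k] B)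
    (hf : IsUnit (f c.elem)) (x : Cox k L) : c.liftTotal f hf (c.toTotal x) = f x :=
  IsLocalization.lift_eq _ x

lemma exists_mul_toTotal_eq (x : c.TotalRing) :
    ∃ (y : Cox k L) (N : ℕ), x * c.toTotal c.elem ^ N = c.toTotal y := by
  obtain ⟨⟨y, _, N, rfl⟩, h⟩ := IsLocalization.surj (Submonoid.powers c.elem) x
  exact ⟨y, N, (congrArg (x * ·) (map_pow c.toTotal c.elem N).symm).trans h⟩

lemma totalHom_ext {B : Type*} [CommRing B] [Algebra k B] {f g : c.TotalRing →ₐ[k] B}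
    (h : ∀ x, f (c.toTotal x) = g (c.toTotal x)) : f = g :=
  IsLocalization.algHom_ext (Submonoid.powers c.elem) (AlgHom.ext h)

/-- The embedding of the localization at the section of a chart in the Laurent polynomial ring over
the function field. -/
def totalToLaurent : c.TotalRing →ₐ[k] AddMonoidAlgebra X.functionField (Fin r → ℤ) :=
  c.liftTotal (coxToLaurent k L) (by
    refine IsUnit.of_mul_eq_one (AddMonoidAlgebra.single (-(c.n • a)) c.s⁻¹) ?_
    unfold elem
    rw [coxToLaurent_coxMk, AddMonoidAlgebra.single_mul_single, add_neg_cancel,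
      mul_inv_cancel₀ c.s_ne_zero]
    rfl)

lemma totalToLaurent_toTotal (x : Cox k L) :
    c.totalToLaurent (c.toTotal x) = coxToLaurent k L x :=
  c.liftTotal_toTotal _ _ x

lemma totalToLaurent_injective : Function.Injective c.totalToLaurent := by
  rw [injective_iff_map_eq_zero]
  intro x hx
  obtain ⟨y, N, h⟩ := c.exists_mul_toTotal_eq x
  have h' := congrArg c.totalToLaurent h
  rw [map_mul, hx, zero_mul, totalToLaurent_toTotal] at h'
  have hy : y = 0 := coxToLaurent_injective (h'.symm.trans (map_zero _).symm)
  rw [hy, map_zero] at h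
  exact ((c.isUnit_toTotal_elem.pow N).mul_left_eq_zero).1 h

/-- The hypothesis says that `f` is a section of `𝒪(∑ mᵢLᵢ)` over the nonvanishing locus of `c.s`,
so `f c.s^N` extends to `X`. An element `x` representing `f χᵐ` is taken as given;
`single_mem_range` provides it. -/
lemma exists_mul_pow_eq_coxMk [CompactSpace X] {m : Fin r → ℤ} {f : X.functionField}
    (hf : ∀ x ∈ c.U, f * c.gpow m ∈ regularAt X x) :
    ∃ (N : ℕ) (h : f * c.s ^ N ∈ coxPiece k L (m + N • c.n • a)), ∀ x : c.TotalRing,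
      c.totalToLaurent x = AddMonoidAlgebra.single m f →
        x * c.toTotal c.elem ^ N = c.toTotal (coxMk k _ _ h) := by
  obtain ⟨N, hN⟩ := exists_mul_pow_mem_H0 k (E := multiDivisor L m) c.s_mem c.s_ne_zero f (by
    intro x hx g hg
    have hxU := (c.mem_U x).2 hx
    have := (regularAt X x).mul_mem (hf x hxU) ((c.isLocalEquation_gpow m hxU).mul_inv_mem hg)
    rwa [show f * c.gpow m * (g * (c.gpow m : X.functionField)⁻¹) = f * g by
      field_simp [(c.gpow m).ne_zero]] at this)
  have h : f * c.s ^ N ∈ coxPiece k L (m + N • c.n • a) := by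
    unfold coxPiece
    rw [map_add, map_nsmul]
    exact hN N le_rfl
  refine ⟨N, h, fun x hx => c.totalToLaurent_injective ?_⟩
  rw [map_mul, map_pow, totalToLaurent_toTotal, totalToLaurent_toTotal, hx, coxToLaurent_coxMk]
  unfold elem
  rw [coxToLaurent_coxMk, AddMonoidAlgebra.single_pow, AddMonoidAlgebra.single_mul_single]

/-- The preimage is the extended section `f c.s^N` divided by the `N`-th power of the chart element.
This criterion produces both the functions on the base and the torus coordinates. -/
lemma single_mem_range [CompactSpace X] {m : Fin r → ℤ} {f : X.functionField}
    (hf : ∀ x ∈ c.U, f * c.gpow m ∈ regularAt X x) :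
    AddMonoidAlgebra.single m f ∈ c.totalToLaurent.range := by
  obtain ⟨N, h, -⟩ := c.exists_mul_pow_eq_coxMk hf
  obtain ⟨v, hv⟩ := c.isUnit_toTotal_elem.pow N
  refine ⟨c.toTotal (coxMk k _ _ h) * (v⁻¹ : c.TotalRingˣ), ?_⟩
  have hu : IsUnit (coxToLaurent k L c.elem ^ N) := by
    rw [← totalToLaurent_toTotal, ← map_pow]
    exact (c.isUnit_toTotal_elem.pow N).map _
  refine hu.mul_right_cancel ?_
  change c.totalToLaurent _ * _ = _
  rw [← totalToLaurent_toTotal, ← map_pow, ← map_mul, ← hv, mul_assoc, Units.inv_mul, mul_one, hv,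
    map_pow, totalToLaurent_toTotal, totalToLaurent_toTotal, coxToLaurent_coxMk]
  unfold elem
  rw [coxToLaurent_coxMk, AddMonoidAlgebra.single_pow, AddMonoidAlgebra.single_mul_single]

/-- Functions on the base of a chart are the elements of degree zero. -/
def proj [CompactSpace X] : c.BaseRing →ₐ[k] c.TotalRing :=
  liftOfInjective c.totalToLaurent c.totalToLaurent_injective
    (AddMonoidAlgebra.singleZeroAlgHom.comp c.baseToField)
    (fun b => c.single_mem_range (m := 0) fun x hx => by
      rw [gpow_zero, Units.val_one, mul_one]
      exact c.baseToField_mem_regularAt b hx)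

lemma totalToLaurent_proj [CompactSpace X] (b : c.BaseRing) :
    c.totalToLaurent (c.proj b) = AddMonoidAlgebra.single 0 (c.baseToField b) :=
  apply_liftOfInjective ..

/-- The evaluation of Laurent polynomials at the local equations of a chart. -/
def eval : AddMonoidAlgebra X.functionField (Fin r → ℤ) →ₐ[k] X.functionField :=
  (AddMonoidAlgebra.lift X.functionField X.functionField (Fin r → ℤ)
    { toFun := fun m => (c.gpow m.toAdd : X.functionField)
      map_one' := by rw [toAdd_one, gpow_zero, Units.val_one]
      map_mul' := fun m m' => by rw [toAdd_mul, gpow_add, Units.val_mul] }).restrictScalars k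

lemma eval_single (m : Fin r → ℤ) (f : X.functionField) :
    c.eval (AddMonoidAlgebra.single m f) = f * c.gpow m :=
  AddMonoidAlgebra.lift_single ..

lemma eval_coxToLaurent_mem (y : Cox k L) {x : X} (hx : x ∈ c.U) :
    c.eval (coxToLaurent k L y) ∈ regularAt X x := by
  induction y using coxMk_induction with
  | zero => rw [map_zero, map_zero]; exact zero_mem _
  | of m f hf =>
    rw [coxToLaurent_coxMk, eval_single]
    exact mul_mem_regularAt_of_mem_H0 hf (c.isLocalEquation_gpow m hx)
  | add y z hy hz => rw [map_add, map_add]; exact add_mem hy hz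

/-- Elements of the Cox ring evaluate to regular functions on `c.U`, and the chart element evaluates
to a unit there, so the denominators do no harm. -/
lemma eval_totalToLaurent_mem (y : c.TotalRing) {x : X} (hx : x ∈ c.U) :
    c.eval (c.totalToLaurent y) ∈ regularAt X x := by
  obtain ⟨z, N, h⟩ := c.exists_mul_toTotal_eq y
  have h' := congrArg (fun w => c.eval (c.totalToLaurent w)) h
  have he : c.eval (coxToLaurent k L c.elem) = c.s * c.gpow (c.n • a) := by
    unfold elem
    rw [coxToLaurent_coxMk, eval_single]
  have hinv : (c.s * c.gpow (c.n • a))⁻¹ ∈ regularAt X x :=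
    ((isNonvanishingAt_iff k c.s_mem (c.isLocalEquation_gpow _ hx)).1 ((c.mem_U x).1 hx)).2
  have hne : c.s * c.gpow (c.n • a) ≠ 0 := mul_ne_zero c.s_ne_zero (c.gpow _).ne_zero
  simp only [map_mul, map_pow, totalToLaurent_toTotal, he] at h'
  have h'' : c.eval (c.totalToLaurent y) =
      c.eval (coxToLaurent k L z) * (c.s * c.gpow (c.n • a))⁻¹ ^ N := by
    rw [← h', mul_assoc, ← mul_pow, mul_inv_cancel₀ hne, one_pow, mul_one]
  rw [h'']
  exact mul_mem (c.eval_coxToLaurent_mem z hx) (pow_mem hinv N)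

/-- The section of a chart defined by the local equations. -/
def sect : c.TotalRing →ₐ[k] c.BaseRing :=
  liftOfInjective c.baseToField c.baseToField_injective (c.eval.comp c.totalToLaurent)
    fun y => c.exists_baseToField_eq fun _ hx => c.eval_totalToLaurent_mem y hx

lemma baseToField_sect (y : c.TotalRing) :
    c.baseToField (c.sect y) = c.eval (c.totalToLaurent y) :=
  apply_liftOfInjective ..

lemma sect_proj [CompactSpace X] (b : c.BaseRing) : c.sect (c.proj b) = b := by
  refine c.baseToField_injective ?_
  rw [baseToField_sect, totalToLaurent_proj, eval_single, gpow_zero, Units.val_one, mul_one]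

lemma totalToLaurent_proj_sect_coxMk [CompactSpace X] {m : Fin r → ℤ} {f : X.functionField}
    (hf : f ∈ coxPiece k L m) :
    c.totalToLaurent (c.proj (c.sect (c.toTotal (coxMk k m f hf)))) =
      AddMonoidAlgebra.single 0 (f * c.gpow m) := by
  rw [totalToLaurent_proj, baseToField_sect, totalToLaurent_toTotal, coxToLaurent_coxMk,
    eval_single]

/-- The characters of the torus as Laurent monomials. -/
def charToLaurent (e : Pic X →+ (Fin r → ℤ)) :
    AddMonoidAlgebra k (Pic X) →ₐ[k] AddMonoidAlgebra X.functionField (Fin r → ℤ) :=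
  AddMonoidAlgebra.lift k _ (Pic X)
    { toFun := fun p => AddMonoidAlgebra.single (e p.toAdd) (c.gpow (-(e p.toAdd)) : X.functionField)
      map_one' := by
        rw [toAdd_one, map_zero, neg_zero, gpow_zero, Units.val_one]
        rfl
      map_mul' := fun p p' => by
        rw [toAdd_mul, map_add, neg_add, gpow_add, Units.val_mul,
          AddMonoidAlgebra.single_mul_single] }

lemma charToLaurent_single (e : Pic X →+ (Fin r → ℤ)) (p : Pic X) :
    c.charToLaurent e (AddMonoidAlgebra.single p 1) =
      AddMonoidAlgebra.single (e p) (c.gpow (-(e p)) : X.functionField) :=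
  (AddMonoidAlgebra.lift_single ..).trans (one_smul ..)

/-- The coordinates of the torus on a chart. -/
def coord [CompactSpace X] (e : Pic X →+ (Fin r → ℤ)) :
    AddMonoidAlgebra k (Pic X) →ₐ[k] c.TotalRing :=
  liftOfInjective c.totalToLaurent c.totalToLaurent_injective (c.charToLaurent e) (by
    intro x
    induction x using AddMonoidAlgebra.induction_on with
    | of p =>
      refine Eq.subst (motive := fun q => q ∈ c.totalToLaurent.range)
        (c.charToLaurent_single e p).symm (c.single_mem_range fun x hx => ?_)
      rw [gpow_neg, Units.inv_mul]
      exact one_mem _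
    | add x y hx hy => rw [map_add]; exact add_mem hx hy
    | smul t x hx => rw [map_smul]; exact Subalgebra.smul_mem _ hx t)

lemma totalToLaurent_coord [CompactSpace X] (e : Pic X →+ (Fin r → ℤ)) (p : Pic X) :
    c.totalToLaurent (c.coord e (AddMonoidAlgebra.single p 1)) =
      AddMonoidAlgebra.single (e p) (c.gpow (-(e p)) : X.functionField) :=
  (apply_liftOfInjective ..).trans (c.charToLaurent_single e p)

/-- In the Laurent ring this is `χᵐ g⁻ᵐ · f gᵐ = f χᵐ`: a point is its torus coordinate applied to
the section point of its fibre. The next lemma is the inverse identity `χ⁻ᵐ gᵐ · f χᵐ = f gᵐ`. -/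
lemma coord_mul_proj_sect [CompactSpace X] {e : Pic X →+ (Fin r → ℤ)}
    (he : ∀ m, e (toPic (multiDivisor L m)) = m) {m : Fin r → ℤ} {f : X.functionField}
    (hf : f ∈ coxPiece k L m) :
    c.coord e (AddMonoidAlgebra.single (toPic (multiDivisor L m)) 1) *
      c.proj (c.sect (c.toTotal (coxMk k m f hf))) = c.toTotal (coxMk k m f hf) := by
  refine c.totalToLaurent_injective ?_
  rw [map_mul, totalToLaurent_coord, totalToLaurent_proj_sect_coxMk, totalToLaurent_toTotal,
    coxToLaurent_coxMk, AddMonoidAlgebra.single_mul_single, he, add_zero, gpow_neg,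
    mul_comm f, Units.inv_mul_cancel_left]

lemma coord_neg_mul [CompactSpace X] {e : Pic X →+ (Fin r → ℤ)}
    (he : ∀ m, e (toPic (multiDivisor L m)) = m) {m : Fin r → ℤ} {f : X.functionField}
    (hf : f ∈ coxPiece k L m) :
    c.coord (-e) (AddMonoidAlgebra.single (toPic (multiDivisor L m)) 1) *
      c.toTotal (coxMk k m f hf) = c.proj (c.sect (c.toTotal (coxMk k m f hf))) := by
  refine c.totalToLaurent_injective ?_
  rw [map_mul, totalToLaurent_coord, totalToLaurent_proj_sect_coxMk, totalToLaurent_toTotal,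
    coxToLaurent_coxMk, AddMonoidAlgebra.single_mul_single, AddMonoidHom.neg_apply, he,
    neg_add_cancel, neg_neg, mul_comm f]

/-- A twist of a homomorphism by characters does not change it in degree zero. -/
lemma comp_proj_eq_of_twist [CompactSpace X] {B : Type*} [CommRing B] [Algebra k B]
    (α : AddMonoidAlgebra k (Pic X) →ₐ[k] B) (β β' : c.TotalRing →ₐ[k] B)
    (h : ∀ m f (hf : f ∈ coxPiece k L m), β' (c.toTotal (coxMk k m f hf)) =
      α (AddMonoidAlgebra.single (toPic (multiDivisor L m)) 1) * β (c.toTotal (coxMk k m f hf))) :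
    β'.comp c.proj = β.comp c.proj := by
  ext b
  -- A function on the base is a fraction with numerator and denominator of the same degree, so the
  -- twist multiplies both by the same character and cancels.
  obtain ⟨N, hN, hx⟩ := c.exists_mul_pow_eq_coxMk (m := 0) (f := c.baseToField b) fun x hx => by
    rw [gpow_zero, Units.val_one, mul_one]
    exact c.baseToField_mem_regularAt b hx
  have hb := hx _ (c.totalToLaurent_proj b)
  have hu := (c.isUnit_toTotal_elem.pow N).map β'
  refine hu.mul_right_cancel ?_
  have h1 : β' (c.toTotal c.elem ^ N) =
      α (AddMonoidAlgebra.single (toPic (multiDivisor L (0 + N • c.n • a))) 1) *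
        β (c.toTotal c.elem ^ N) := by
    rw [zero_add, ← map_pow c.toTotal]
    unfold elem
    rw [coxMk_pow]
    exact h _ _ _
  rw [AlgHom.comp_apply, AlgHom.comp_apply, ← map_mul, hb, h, h1, ← hb, map_mul]
  ring

end Chart

end ChartRings

end CoxQuotient

end
noncomputable section

namespace CoxQuotient

/-! ### Factoring through open immersions -/

section OpenImmersions

variable {S : Scheme.{u}} {Z U Y : Over S} (i : U ⟶ Y) [IsOpenImmersion i.left] (f : Z ⟶ Y)
  (h : Set.range f.left ⊆ Set.range i.left)

/-- The factorization of a morphism over `S` through an open immersion containing its range. -/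
def overLift : Z ⟶ U :=
  Over.homMk (IsOpenImmersion.lift i.left f.left h) (by
    rw [← Over.w i, IsOpenImmersion.lift_fac_assoc, Over.w f])

@[simp]
lemma overLift_comp : overLift i f h ≫ i = f := by
  ext1
  exact IsOpenImmersion.lift_fac _ _ _

lemma mono_of_isOpenImmersion_left : Mono i := Over.mono_of_mono_left _

end OpenImmersions

/-! ### The torus action restricts to the semistable locus -/

section SemistableAction

variable {k : Type u} [Field k] {X : Scheme.{u}} [IsIntegral X] [X.Over (Spec (.of k))] {r : ℕ}
  (L : Fin r → CartierDivisor X) (D : CartierDivisor X)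

variable {L D} in
lemma mem_semistable_iff {p : PrimeSpectrum (Cox k L)} :
    (show totalSpace k L from p) ∈ semistable k L D ↔ ∃ n : ℕ, 0 < n ∧ ∃ m : Fin r → ℤ,
      toPic (multiDivisor L m) = n • toPic D ∧ ∃ s : coxPiece k L m,
        coxOf k L m s ∉ p.asIdeal := by
  change ¬ ((irrelevantIdeal k L D : Set (Cox k L)) ⊆ p.asIdeal) ↔ _
  rw [irrelevantIdeal, SetLike.coe_subset_coe, p.2.radical_le_iff, sectionIdeal, Ideal.span_le,
    Set.not_subset]
  constructor
  · rintro ⟨_, ⟨n, hn, m, hm, s, rfl⟩, hs⟩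
    exact ⟨n, hn, m, hm, s, hs⟩
  · rintro ⟨n, hn, m, hm, s, hs⟩
    exact ⟨_, ⟨n, hn, m, hm, s, rfl⟩, hs⟩

/-- The two inclusions into the tensor product form the universal point of `T_X × X̄`, so statements
about points of the product reduce to this one pair of homomorphisms. -/
lemma exists_specMap_lift_eq (w : (torus k X ⊗ totalSpaceOver k L).left) :
    ∃ w' : Spec (.of (AddMonoidAlgebra k (Pic X) ⊗[k] Cox k L)),
      (lift (specMap Algebra.TensorProduct.includeLeft : _ ⟶ torus k X)
        (specMap Algebra.TensorProduct.includeRight : _ ⟶ totalSpaceOver k L)).left w' = w := by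
  have e : (lift (specMap Algebra.TensorProduct.includeLeft : _ ⟶ torus k X)
        (specMap Algebra.TensorProduct.includeRight : _ ⟶ totalSpaceOver k L)).left =
      (pullbackSpecIso k (AddMonoidAlgebra k (Pic X)) (Cox k L)).inv := by
    refine (pullback_lift_specMap (k := k) _ _ ((Over.w (specMap _)).trans
      (Over.w (specMap _)).symm)).trans ?_
    rw [show (Algebra.TensorProduct.lift (Algebra.TensorProduct.includeLeft :
        AddMonoidAlgebra k (Pic X) →ₐ[k] AddMonoidAlgebra k (Pic X) ⊗[k] Cox k L)
        Algebra.TensorProduct.includeRight fun _ _ => Commute.all _ _) = AlgHom.id k _ from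
      Algebra.TensorProduct.ext (by ext; simp) (by ext; simp)]
    exact (congrArg (· ≫ _) (Spec.map_id _)).trans (Category.id_comp _)
  refine ⟨(pullbackSpecIso k (AddMonoidAlgebra k (Pic X)) (Cox k L)).hom w, ?_⟩
  rw [e]
  exact congrArg (fun φ => φ w)
    (pullbackSpecIso k (AddMonoidAlgebra k (Pic X)) (Cox k L)).hom_inv_id

/-- The action multiplies a homogeneous element by a character, which is a unit, so it does not
change where that element vanishes. -/
lemma smul_mem_semistable (w : (torus k X ⊗ totalSpaceOver k L).left)
    (hw : (snd (torus k X) (totalSpaceOver k L)).left w ∈ semistable k L D) :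
    (γ[torus k X, totalSpaceOver k L]).left w ∈ semistable k L D := by
  obtain ⟨w, rfl⟩ := exists_specMap_lift_eq L w
  have h1 := congrArg (fun φ => φ.left w) (lift_snd
    (specMap Algebra.TensorProduct.includeLeft : _ ⟶ torus k X)
    (specMap Algebra.TensorProduct.includeRight : _ ⟶ totalSpaceOver k L))
  have h2 := congrArg (fun φ => φ.left w) (lift_specMap_smul L
    (Algebra.TensorProduct.includeLeft : AddMonoidAlgebra k (Pic X) →ₐ[k]
      AddMonoidAlgebra k (Pic X) ⊗[k] Cox k L) Algebra.TensorProduct.includeRight)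
  obtain ⟨n, hn, m, hm, s, hs⟩ := mem_semistable_iff.1 (h1 ▸ hw)
  refine Set.mem_of_eq_of_mem h2 (mem_semistable_iff.2 ⟨n, hn, m, hm, s, fun h => hs ?_⟩)
  have hu : IsUnit (AddMonoidAlgebra.single (toPic (multiDivisor L m)) (1 : k)) := by
    refine IsUnit.of_mul_eq_one (AddMonoidAlgebra.single (-toPic (multiDivisor L m)) 1) ?_
    rw [AddMonoidAlgebra.single_mul_single, add_neg_cancel, mul_one]
    rfl
  have h' : ((Algebra.TensorProduct.lift (Algebra.TensorProduct.includeLeft :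
        AddMonoidAlgebra k (Pic X) →ₐ[k] AddMonoidAlgebra k (Pic X) ⊗[k] Cox k L)
        Algebra.TensorProduct.includeRight fun _ _ => Commute.all _ _).comp (coaction k L))
      (coxOf k L m s) ∈ w.asIdeal := h
  rw [lift_comp_coaction_coxOf] at h'
  have hu' : IsUnit ((Algebra.TensorProduct.includeLeft : AddMonoidAlgebra k (Pic X) →ₐ[k]
      AddMonoidAlgebra k (Pic X) ⊗[k] Cox k L)
        (AddMonoidAlgebra.single (toPic (multiDivisor L m)) (1 : k))) := hu.map _
  exact (Ideal.unit_mul_mem_iff_mem w.asIdeal hu').1 h'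

instance : IsOpenImmersion (semistableInclusion k L D).left :=
  inferInstanceAs (IsOpenImmersion (semistable k L D).ι)

instance : Mono (semistableInclusion k L D) := mono_of_isOpenImmersion_left _

variable {L D} in
lemma mem_range_semistableInclusion_iff {y : (totalSpaceOver k L).left} :
    y ∈ Set.range (semistableInclusion k L D).left ↔ y ∈ semistable k L D :=
  ⟨fun ⟨w, hw⟩ => hw ▸ w.2, fun h => ⟨⟨y, h⟩, rfl⟩⟩

lemma range_whiskerLeft_smul_subset :
    Set.range (torus k X ◁ semistableInclusion k L D ≫ γ[torus k X, totalSpaceOver k L]).left ⊆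
      Set.range (semistableInclusion k L D).left := by
  rintro _ ⟨w, rfl⟩
  refine mem_range_semistableInclusion_iff.2 (smul_mem_semistable L D _ ?_)
  refine mem_range_semistableInclusion_iff.1 ⟨(snd (torus k X) (semistableOver k L D)).left w, ?_⟩
  exact congrArg (fun φ => φ.left w)
    (whiskerLeft_snd (torus k X) (semistableInclusion k L D)).symm

/-- The restriction of the action `T_X × X̄ → X̄` to `X̂`. -/
def semistableSMul : torus k X ⊗ semistableOver k L D ⟶ semistableOver k L D :=
  overLift (semistableInclusion k L D) _ (range_whiskerLeft_smul_subset L D)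

lemma semistableSMul_comp : semistableSMul L D ≫ semistableInclusion k L D =
    torus k X ◁ semistableInclusion k L D ≫ γ[torus k X, totalSpaceOver k L] :=
  overLift_comp _ _ _

/-- The action of `T_X` on `X̂`. -/
@[reducible]
def semistableAction : ModObj (torus k X) (semistableOver k L D) :=
  ModObj.ofMono (semistableInclusion k L D) (semistableSMul L D) (semistableSMul_comp L D)

lemma isModHom_semistableInclusion :
    letI := semistableAction (k := k) L D
    IsModHom (torus k X) (semistableInclusion k L D) :=
  letI := semistableAction (k := k) L D
  ⟨semistableSMul_comp L D⟩

end SemistableAction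

/-! ### Quotient morphisms on charts and their compatibility -/

section ChartMaps

variable {k : Type u} [Field k] {X : Scheme.{u}} [IsIntegral X] [X.Over (Spec (.of k))] {r : ℕ}
  {L : Fin r → CartierDivisor X} {a : Fin r → ℤ}

namespace Chart

variable (c : Chart k L a)

/-- The base of a chart as a scheme over `k`. -/
abbrev baseOver : Over (Spec (.of k)) := (Spec (.of c.BaseRing)).asOver (Spec (.of k))

/-- The total space of a chart as a scheme over `k`. -/
abbrev totalOver : Over (Spec (.of k)) := (Spec (.of c.TotalRing)).asOver (Spec (.of k))

/-- The inclusion of the base of a chart. -/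
def baseInclusion : c.baseOver ⟶ X.asOver (Spec (.of k)) :=
  Over.homMk c.affine.fromSpec (by
    change c.affine.fromSpec ≫ X ↘ Spec (.of k) = Spec.map _
    rw [eq_toSpecΓ_comp (X ↘ Spec (.of k)), c.affine.fromSpec_toSpecΓ_assoc, ← Spec.map_comp]
    rfl)

instance isOpenImmersion_baseInclusion : IsOpenImmersion c.baseInclusion.left :=
  inferInstanceAs (IsOpenImmersion c.affine.fromSpec)

lemma range_baseInclusion : Set.range c.baseInclusion.left = (show Set X from c.U) :=
  c.affine.range_fromSpec

/-- The inclusion of the total space of a chart in `X̄`. -/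
abbrev totalToSpace : c.totalOver ⟶ totalSpaceOver k L := specMap c.toTotal

instance isOpenImmersion_totalToSpace : IsOpenImmersion c.totalToSpace.left :=
  inferInstanceAs (IsOpenImmersion (Spec.map (CommRingCat.ofHom
    (algebraMap (Cox k L) (Localization.Away c.elem)))))

lemma range_totalToSpace : Set.range c.totalToSpace.left =
    {p : PrimeSpectrum (Cox k L) | c.elem ∉ p.asIdeal} :=
  PrimeSpectrum.localization_away_comap_range (Localization.Away c.elem) c.elem

variable {D : CartierDivisor X} (ha : toPic (multiDivisor L a) = toPic D)

include ha in
lemma range_totalToSpace_subset :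
    Set.range c.totalToSpace.left ⊆ Set.range (semistableInclusion k L D).left := by
  rw [range_totalToSpace]
  intro p hp
  exact mem_range_semistableInclusion_iff.2 (mem_semistable_iff.2
    ⟨c.n, c.n_pos, c.n • a, by rw [map_nsmul, map_nsmul, ha], _, hp⟩)

/-- The inclusion of the total space of a chart in `X̂`. -/
def totalInclusion : c.totalOver ⟶ semistableOver k L D :=
  overLift (semistableInclusion k L D) c.totalToSpace (c.range_totalToSpace_subset ha)

lemma totalInclusion_comp :
    c.totalInclusion ha ≫ semistableInclusion k L D = c.totalToSpace :=
  overLift_comp _ _ _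

instance isOpenImmersion_totalInclusion : IsOpenImmersion (c.totalInclusion ha).left := by
  have : IsOpenImmersion ((c.totalInclusion ha).left ≫ (semistableInclusion k L D).left) := by
    rw [← Over.comp_left, totalInclusion_comp]
    exact c.isOpenImmersion_totalToSpace
  exact IsOpenImmersion.of_comp _ (semistableInclusion k L D).left

lemma mem_range_totalInclusion_iff (y : (semistableOver k L D).left) :
    y ∈ Set.range (c.totalInclusion ha).left ↔
      c.elem ∉ (show PrimeSpectrum (Cox k L) from (semistableInclusion k L D).left y).asIdeal := by
  have h : (semistableInclusion k L D).left y ∈ Set.range c.totalToSpace.left ↔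
      c.elem ∉ (show PrimeSpectrum (Cox k L) from (semistableInclusion k L D).left y).asIdeal := by
    rw [range_totalToSpace]
    exact Iff.rfl
  rw [← h, ← totalInclusion_comp c ha]
  constructor
  · rintro ⟨z, rfl⟩
    exact ⟨z, rfl⟩
  · rintro ⟨z, hz⟩
    exact ⟨z, (semistableInclusion k L D).left.isOpenEmbedding.injective hz⟩

variable {c} in
/-- The restriction to the base of a smaller chart. -/
def resBase {d : Chart k L a} (h : d.U ≤ c.U) : c.BaseRing →+* d.BaseRing :=
  (X.presheaf.map (homOfLE h).op).hom

lemma baseToField_resBase (d : Chart k L a) (h : d.U ≤ c.U) (b : c.BaseRing) :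
    d.baseToField (resBase h b) = c.baseToField b :=
  toFunctionField_res h d.generic_mem b

variable [CompactSpace X]

/-- The quotient morphism on a chart. -/
def quot : c.totalOver ⟶ X.asOver (Spec (.of k)) := specMap c.proj ≫ c.baseInclusion

/-- Both sides have the same image in the Laurent ring, where restricting a function does not change
it as a rational function. -/
lemma liftTotal_proj (d : Chart k L a) (h : d.U ≤ c.U) (hu : IsUnit (d.toTotal c.elem))
    (b : c.BaseRing) : c.liftTotal d.toTotal hu (c.proj b) = d.proj (resBase h b) := by
  have e : d.totalToLaurent.comp (c.liftTotal d.toTotal hu) = c.totalToLaurent :=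
    c.totalHom_ext fun x => by
      rw [AlgHom.comp_apply, liftTotal_toTotal, totalToLaurent_toTotal, totalToLaurent_toTotal]
  refine d.totalToLaurent_injective ?_
  rw [← AlgHom.comp_apply, e, totalToLaurent_proj, totalToLaurent_proj, baseToField_resBase]

lemma specMap_liftTotal_quot (d : Chart k L a) (h : d.U ≤ c.U) (hu : IsUnit (d.toTotal c.elem)) :
    specMap (c.liftTotal d.toTotal hu) ≫ c.quot = d.quot := by
  have h1 : (CommRingCat.ofHom (c.proj : c.BaseRing →+* c.TotalRing)) ≫
      CommRingCat.ofHom (c.liftTotal d.toTotal hu : c.TotalRing →+* d.TotalRing) =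
      CommRingCat.ofHom (resBase h) ≫ CommRingCat.ofHom (d.proj : d.BaseRing →+* d.TotalRing) := by
    ext b
    exact c.liftTotal_proj d h hu b
  have h2 := congrArg Spec.map h1
  rw [Spec.map_comp, Spec.map_comp] at h2
  have h3 : Spec.map (CommRingCat.ofHom (resBase h)) ≫ c.baseInclusion.left =
      d.baseInclusion.left := c.affine.map_fromSpec d.affine (homOfLE h).op
  ext1
  have h4 := congrArg (· ≫ c.baseInclusion.left) h2
  refine ((Category.assoc _ _ _).symm.trans h4).trans ((Category.assoc _ _ _).trans ?_)
  exact congrArg (_ ≫ ·) h3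

lemma quot_eq_of_isUnit {Z : Over (Spec (.of k))} (z : Z ⟶ c.totalOver) (d : Chart k L a)
    (h : d.U ≤ c.U) (hu : IsUnit (d.toTotal c.elem)) (z' : Z ⟶ d.totalOver)
    (hz : z ≫ c.totalToSpace = z' ≫ d.totalToSpace) : z ≫ c.quot = z' ≫ d.quot := by
  have : Mono c.totalToSpace := mono_of_isOpenImmersion_left _
  have e : z = z' ≫ specMap (c.liftTotal d.toTotal hu) := by
    have e' : d.toTotal = (c.liftTotal d.toTotal hu).comp c.toTotal :=
      AlgHom.ext fun x => (c.liftTotal_toTotal d.toTotal hu x).symm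
    rw [← cancel_mono c.totalToSpace, hz, Category.assoc, ← specMap_comp, ← e']
  rw [e, Category.assoc, specMap_liftTotal_quot _ _ h]

/-- A common point of `D(c.elem)` and `D(c'.elem)` lies in the total space of the product chart, and
both quotient morphisms restrict to the one there. -/
lemma quot_eq_quot (c' : Chart k L a) {Z : Over (Spec (.of k))} (z : Z ⟶ c.totalOver)
    (z' : Z ⟶ c'.totalOver) (hz : z ≫ c.totalToSpace = z' ≫ c'.totalToSpace) :
    z ≫ c.quot = z' ≫ c'.quot := by
  have hrange : Set.range (z ≫ c.totalToSpace).left ⊆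
      Set.range (c.mul c').totalToSpace.left := by
    rw [range_totalToSpace]
    rintro _ ⟨x, rfl⟩
    have h1 : (z ≫ c.totalToSpace).left x ∈ Set.range c.totalToSpace.left := ⟨z.left x, rfl⟩
    have h2 : (z ≫ c.totalToSpace).left x ∈ Set.range c'.totalToSpace.left := by
      rw [hz]; exact ⟨z'.left x, rfl⟩
    rw [range_totalToSpace] at h1 h2
    intro h
    rw [elem_mul] at h
    exact (Ideal.IsPrime.mem_or_mem (PrimeSpectrum.isPrime _) h).elim h1 h2
  have hw := overLift_comp (c.mul c').totalToSpace _ hrange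
  have hu : IsUnit ((c.mul c').toTotal (c.elem * c'.elem)) :=
    c.elem_mul c' ▸ (c.mul c').isUnit_toTotal_elem
  rw [map_mul, IsUnit.mul_iff] at hu
  rw [c.quot_eq_of_isUnit z (c.mul c') inf_le_left hu.1 _ hw.symm,
    c'.quot_eq_of_isUnit z' (c.mul c') inf_le_right hu.2 _ (hz.symm.trans hw.symm)]

end Chart

end ChartMaps

end CoxQuotient

end
noncomputable section

namespace CoxQuotient

/-! ### Glueing morphisms over a base -/

section Glueing

open Limits

lemma exists_over_glue {S : Scheme.{u}} {Y X : Over S} {I : Type u} {U : I → Over S}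
    (i : ∀ c, U c ⟶ Y) [∀ c, IsOpenImmersion (i c).left]
    (hcov : ∀ y : Y.left, ∃ c, y ∈ Set.range (i c).left) (f : ∀ c, U c ⟶ X)
    (h : ∀ c d (Z : Over S) (z : Z ⟶ U c) (w : Z ⟶ U d), z ≫ i c = w ≫ i d → z ≫ f c = w ≫ f d) :
    ∃ φ : Y ⟶ X, ∀ c, i c ≫ φ = f c := by
  let 𝒰 : Scheme.OpenCover.{u} Y.left :=
    Scheme.Cover.mkOfCovers I (fun c => (U c).left) (fun c => (i c).left) hcov
  have hf : ∀ c d : I, pullback.fst (i c).left (i d).left ≫ (f c).left =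
      pullback.snd (i c).left (i d).left ≫ (f d).left := by
    intro c d
    have e : pullback.snd (i c).left (i d).left ≫ (U d).hom =
        pullback.fst (i c).left (i d).left ≫ (U c).hom := by
      rw [← Over.w (i c), ← Over.w (i d), pullback.condition_assoc]
    refine congrArg (fun φ => φ.left) (h c d
      (Over.mk (pullback.fst (i c).left (i d).left ≫ (U c).hom))
      (Over.homMk (pullback.fst _ _)) (Over.homMk (pullback.snd _ _) e) ?_)
    ext1
    exact pullback.condition
  have hι := Scheme.Cover.ι_glueMorphisms 𝒰 (fun c => (f c).left) hf
  refine ⟨Over.homMk (Scheme.Cover.glueMorphisms 𝒰 (fun c => (f c).left) hf) ?_, fun c => ?_⟩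
  · refine Scheme.Cover.hom_ext 𝒰 _ _ fun c => ?_
    rw [← Category.assoc, hι]
    exact (Over.w (f c)).trans (Over.w (i c)).symm
  · ext1
    exact hι c

end Glueing

/-! ### Construction of the quotient morphism -/

section Quotient

variable {k : Type u} [Field k] {X : Scheme.{u}} [IsIntegral X] [X.Over (Spec (.of k))] {r : ℕ}
  {L : Fin r → CartierDivisor X} {a : Fin r → ℤ}

lemma lift_semistableSMul_comp (D : CartierDivisor X) {W : Over (Spec (.of k))}
    (g : W ⟶ torus k X) (y : W ⟶ semistableOver k L D) :
    (lift g y ≫ semistableSMul L D) ≫ semistableInclusion k L D =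
      lift g (y ≫ semistableInclusion k L D) ≫ γ[torus k X, totalSpaceOver k L] := by
  rw [Category.assoc, semistableSMul_comp, lift_whiskerLeft_assoc]

lemma algHom_ext_coxMk {B : Type*} [CommRing B] [Algebra k B] {f g : Cox k L →ₐ[k] B}
    (h : ∀ m s hs, f (coxMk k m s hs) = g (coxMk k m s hs)) : f = g :=
  AlgHom.ext fun x => by
    induction x using coxMk_induction with
    | zero => rw [map_zero, map_zero]
    | of m s hs => exact h m s hs
    | add x y hx hy => rw [map_add, map_add, hx, hy]

namespace Chart

variable (c : Chart k L a) {D : CartierDivisor X} (ha : toPic (multiDivisor L a) = toPic D)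

lemma lift_totalInclusion_smul_comp {B : Type u} [CommRing B] [Algebra k B]
    (α : AddMonoidAlgebra k (Pic X) →ₐ[k] B) (β : c.TotalRing →ₐ[k] B) :
    (lift (specMap α : _ ⟶ torus k X) (specMap β ≫ c.totalInclusion ha) ≫
        semistableSMul L D) ≫ semistableInclusion k L D =
      specMap ((Algebra.TensorProduct.lift α (β.comp c.toTotal) fun _ _ => Commute.all _ _).comp
        (coaction k L)) := by
  rw [lift_semistableSMul_comp, Category.assoc, totalInclusion_comp, ← specMap_comp,
    lift_specMap_smul]

variable [CompactSpace X]

section Glued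

variable {c} {π : semistableOver k L D ⟶ X.asOver (Spec (.of k))}
  (hπ : ∀ c : Chart k L a, c.totalInclusion ha ≫ π = c.quot)

lemma proj_mul_toTotal_elem_pow (d : Chart k L a) {e : c.BaseRing}
    (he : c.baseToField e = d.s ^ c.n * (c.s ^ d.n)⁻¹) :
    c.proj e * c.toTotal c.elem ^ d.n = c.toTotal d.elem ^ c.n := by
  refine c.totalToLaurent_injective ?_
  rw [map_mul, totalToLaurent_proj, ← map_pow, ← map_pow, totalToLaurent_toTotal,
    totalToLaurent_toTotal]
  unfold elem
  rw [coxMk_pow, coxMk_pow, coxToLaurent_coxMk, coxToLaurent_coxMk, AddMonoidAlgebra.single_mul_single, he, zero_add, smul_smul, smul_smul,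
    mul_comm d.n, inv_mul_cancel_right₀ (pow_ne_zero _ c.s_ne_zero)]

lemma apply_totalInclusion (hπ : c.totalInclusion ha ≫ π = c.quot) (z : c.totalOver.left) :
    π.left ((c.totalInclusion ha).left z) = c.baseInclusion.left ((specMap c.proj).left z) :=
  congrArg (fun φ => φ.left z) hπ

/-- The ratio of the two charts is a function on the base of `c` that does not vanish at the image
of `z`. Times a power of the unit `c.elem` it equals a power of `d.elem`, so `d.elem` does not
vanish at `z`. -/
lemma toTotal_elem_notMem (d : Chart k L a) (z : PrimeSpectrum c.TotalRing)
    (hz : c.affine.fromSpec (z.comap c.proj.toRingHom) ∈ d.U) :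
    c.toTotal d.elem ∉ z.asIdeal := by
  obtain ⟨e, he, hU⟩ := c.exists_ratio d
  have h1 : c.affine.fromSpec (z.comap c.proj.toRingHom) ∈ X.basicOpen e := by
    rw [hU]
    refine ⟨?_, hz⟩
    have h := Set.mem_range_self (f := c.affine.fromSpec) (z.comap c.proj.toRingHom)
    rwa [c.affine.range_fromSpec] at h
  have h2 : z.comap c.proj.toRingHom ∈ PrimeSpectrum.basicOpen e :=
    (c.affine.fromSpec_preimage_basicOpen e).le h1
  have h3 : c.proj e ∉ z.asIdeal := h2
  have h4 : c.toTotal c.elem ∉ z.asIdeal := fun h =>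
    z.2.ne_top (Ideal.eq_top_of_isUnit_mem _ h c.isUnit_toTotal_elem)
  intro h
  have h5 := Ideal.pow_mem_of_mem z.asIdeal h c.n c.n_pos
  rw [← c.proj_mul_toTotal_elem_pow d he] at h5
  exact (z.2.mem_or_mem h5).elim h3 fun h => h4 (z.2.mem_of_pow_mem _ h)

include hπ in
/-- The preimage of the base of a chart is its total space. -/
lemma range_totalInclusion (hY : ∀ y : (semistableOver k L D).left, ∃ c : Chart k L a,
    y ∈ Set.range (c.totalInclusion ha).left) (c : Chart k L a) :
    Set.range (c.totalInclusion ha).left = π.left ⁻¹' Set.range c.baseInclusion.left := by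
  refine Set.Subset.antisymm ?_ fun y hy => ?_
  · rintro _ ⟨z, rfl⟩
    exact ⟨_, (apply_totalInclusion ha (hπ c) z).symm⟩
  · obtain ⟨d, z, rfl⟩ := hY y
    have h1 : d.affine.fromSpec ((show PrimeSpectrum d.TotalRing from z).comap d.proj.toRingHom) ∈
        c.U := by
      have h := c.range_baseInclusion ▸ hy
      exact apply_totalInclusion ha (hπ d) z ▸ h
    have h2 := d.toTotal_elem_notMem c z h1
    rw [mem_range_totalInclusion_iff]
    have h3 := congrArg (fun φ => φ.left z) (d.totalInclusion_comp ha)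
    exact fun h => h2 ((congrArg (fun p : PrimeSpectrum (Cox k L) => c.elem ∈ p.asIdeal) h3).mp h)

/-- The coordinates of a chart trivialize the quotient morphism over its base. -/
def localTrivialization (hY : ∀ y : (semistableOver k L D).left, ∃ c : Chart k L a,
      y ∈ Set.range (c.totalInclusion ha).left) {e : Pic X →+ (Fin r → ℤ)}
    (he : ∀ m, e (toPic (multiDivisor L m)) = m) (c : Chart k L a) :
    letI := semistableAction (k := k) L D
    LocalTrivialization (torus k X) π :=
  letI := semistableAction (k := k) L D
  { base := c.baseOver
    total := c.totalOver
    u := c.baseInclusion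
    p := c.totalInclusion ha
    q := specMap c.proj
    σ := specMap c.sect
    τ := specMap (c.coord e)
    τ' := specMap (c.coord (-e))
    openImmersion_u := c.isOpenImmersion_baseInclusion
    openImmersion_p := c.isOpenImmersion_totalInclusion ha
    range_p := range_totalInclusion ha hπ hY c
    comm := (hπ c).symm
    section_q := by
      rw [← specMap_comp, ← specMap_id]
      exact congrArg specMap (AlgHom.ext c.sect_proj)
    smul_eq := by
      rw [← Category.assoc, ← specMap_comp, ← cancel_mono (semistableInclusion k L D),
        totalInclusion_comp]
      refine (c.lift_totalInclusion_smul_comp ha _ _).trans (congrArg specMap ?_)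
      refine algHom_ext_coxMk fun m s hs => ?_
      exact (lift_comp_coaction_coxOf L _ _ m ⟨s, hs⟩).trans (c.coord_mul_proj_sect he hs)
    smul_eq' := by
      rw [← Category.assoc, ← specMap_comp, ← cancel_mono (semistableInclusion k L D),
        Category.assoc (specMap _), totalInclusion_comp, ← specMap_comp,
        ← Category.id_comp (c.totalInclusion ha), ← specMap_id]
      refine (c.lift_totalInclusion_smul_comp ha _ _).trans (congrArg specMap ?_)
      refine algHom_ext_coxMk fun m s hs => ?_
      exact (lift_comp_coaction_coxOf L _ _ m ⟨s, hs⟩).trans (c.coord_neg_mul he hs) }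

include hπ in
-- Tested on `B`-valued points `(α, β)` with `β` in a chart: the translate stays in the chart and is
-- the twist of `β` by `α`, which agrees with `β` in degree zero.
lemma semistableSMul_comp_eq (hY : ∀ y : (semistableOver k L D).left, ∃ c : Chart k L a,
      y ∈ Set.range (c.totalInclusion ha).left) :
    semistableSMul L D ≫ π = snd (torus k X) (semistableOver k L D) ≫ π := by
  refine over_hom_ext_of_affine (fun c : Chart k L a =>
    (snd (torus k X) (semistableOver k L D)).left ⁻¹ᵁ (c.totalInclusion ha).left.opensRange)
    (fun w => hY _) fun c B _ _ x hx => ?_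
  obtain ⟨α, hα⟩ := exists_specMap_eq (x ≫ fst _ _)
  have hr : Set.range (x ≫ snd _ _).left ⊆ Set.range (c.totalInclusion ha).left := by
    rintro _ ⟨w, rfl⟩
    exact hx ⟨w, rfl⟩
  obtain ⟨β, hβ⟩ := exists_specMap_eq (overLift (c.totalInclusion ha) _ hr)
  have hβ' : specMap β ≫ c.totalInclusion ha = x ≫ snd _ _ := by rw [hβ, overLift_comp]
  have hx' : x = lift (specMap α) (specMap β ≫ c.totalInclusion ha) := by
    rw [hα, hβ']
    ext1 <;> simp
  let δ := (Algebra.TensorProduct.lift α (β.comp c.toTotal) fun _ _ => Commute.all _ _).comp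
    (coaction k L)
  have hδ : ∀ m s hs, δ (coxMk k m s hs) = α (AddMonoidAlgebra.single (toPic (multiDivisor L m)) 1) *
      β (c.toTotal (coxMk k m s hs)) := fun m s hs => lift_comp_coaction_coxOf L _ _ m ⟨s, hs⟩
  -- The translated point still inverts the chart element, since a character is a unit.
  have hu : IsUnit (δ c.elem) := by
    have hu' : IsUnit (AddMonoidAlgebra.single (toPic (multiDivisor L (c.n • a))) (1 : k)) := by
      refine IsUnit.of_mul_eq_one
        (AddMonoidAlgebra.single (-toPic (multiDivisor L (c.n • a))) 1) ?_
      rw [AddMonoidAlgebra.single_mul_single, add_neg_cancel, mul_one]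
      rfl
    exact (hδ _ _ c.s_mem).symm ▸ (hu'.map α).mul (c.isUnit_toTotal_elem.map β)
  have h1 : x ≫ semistableSMul L D = specMap (c.liftTotal δ hu) ≫ c.totalInclusion ha := by
    rw [← cancel_mono (semistableInclusion k L D), Category.assoc (specMap _),
      totalInclusion_comp, ← specMap_comp, hx']
    refine (c.lift_totalInclusion_smul_comp ha _ _).trans (congrArg specMap ?_)
    exact AlgHom.ext fun y => (c.liftTotal_toTotal δ hu y).symm
  have h2 : (c.liftTotal δ hu).comp c.proj = β.comp c.proj :=
    c.comp_proj_eq_of_twist α β _ fun m s hs => (c.liftTotal_toTotal δ hu _).trans (hδ m s hs)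
  rw [← Category.assoc, h1, ← Category.assoc, ← hβ', Category.assoc, Category.assoc, hπ, quot,
    ← Category.assoc, ← Category.assoc, ← specMap_comp, ← specMap_comp, h2]

include hπ in
lemma isAffineHom_quotient (hX : ∀ x : X, ∃ c : Chart k L a, x ∈ c.U)
    (hY : ∀ y : (semistableOver k L D).left, ∃ c : Chart k L a,
      y ∈ Set.range (c.totalInclusion ha).left) : IsAffineHom π.left := by
  refine isAffineHom_of_forall_exists_isAffineOpen _ fun x => ?_
  obtain ⟨c, hc⟩ := hX x
  refine ⟨c.U, hc, c.affine, ?_⟩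
  have h : π.left ⁻¹ᵁ (show X.Opens from c.U) = (c.totalInclusion ha).left.opensRange := by
    ext1
    exact (congrArg (π.left ⁻¹' ·) c.range_baseInclusion).symm.trans
      (range_totalInclusion ha hπ hY c).symm
  have : IsAffine c.totalOver.left := inferInstanceAs (IsAffine (Spec (.of c.TotalRing)))
  exact h ▸ isAffineOpen_opensRange (c.totalInclusion ha).left

end Glued

end Chart

lemma exists_mem_range_totalInclusion [IsProper (X ↘ Spec (.of k))] {D : CartierDivisor X}
    (ha : toPic (multiDivisor L a) = toPic D) {e : Pic X →+ (Fin r → ℤ)}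
    (he : ∀ m, e (toPic (multiDivisor L m)) = m) (hX : ∀ x : X, ∃ c : Chart k L a, x ∈ c.U)
    (y : (semistableOver k L D).left) :
    ∃ c : Chart k L a, y ∈ Set.range (c.totalInclusion ha).left := by
  obtain ⟨n, hn, m, hm, s, hs⟩ := mem_semistable_iff.1
    (mem_range_semistableInclusion_iff.1 ⟨y, rfl⟩ :
      (semistableInclusion k L D).left y ∈ semistable k L D)
  -- The ideal is defined by degrees in `Pic X`; independence of the classes of the `Lᵢ` pins down
  -- the multidegree.
  obtain rfl : m = n • a := by rw [← he m, hm, ← ha, map_nsmul, he]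
  obtain ⟨c, hc⟩ := exists_chart_notMem hX _ (PrimeSpectrum.isPrime _) hn s.2 hs
  exact ⟨c, (c.mem_range_totalInclusion_iff ha y).2 hc⟩

theorem exists_isGoodGeometricQuotient [IsProper (X ↘ Spec (.of k))] {D : CartierDivisor X}
    (hD : IsAmple k D) (e : Pic X →+ (Fin r → ℤ)) (he : ∀ m, e (toPic (multiDivisor L m)) = m)
    (he' : ∀ P, toPic (multiDivisor L (e P)) = P) :
    letI := semistableAction (k := k) L D
    ∃ π : semistableOver k L D ⟶ X.asOver (Spec (.of k)),
      IsGoodGeometricQuotient (torus k X) π := by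
  have := hD.compact
  -- The ample divisor is replaced by the linearly equivalent `∑ aᵢLᵢ`, where `a` is the coordinate
  -- vector of its class.
  have ha := he' (toPic D)
  have hX := fun x => exists_chart_mem (hD.of_toPic_eq k ha) x
  have hY := exists_mem_range_totalInclusion ha he hX
  obtain ⟨π, hπ⟩ := exists_over_glue (fun c : Chart k L (e (toPic D)) => c.totalInclusion ha) hY
    (fun c => c.quot) fun c d Z z w h => c.quot_eq_quot d z w (by
      rw [← c.totalInclusion_comp ha, ← d.totalInclusion_comp ha, ← Category.assoc, h,
        Category.assoc])
  let := semistableAction (k := k) L D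
  refine ⟨π, isGoodGeometricQuotient_of_localTrivialization (torus k X)
    (Chart.semistableSMul_comp_eq ha hπ hY) (Chart.isAffineHom_quotient ha hπ hX hY) fun x => ?_⟩
  obtain ⟨c, hc⟩ := hX x
  exact ⟨Chart.localTrivialization ha hπ hY he c, c.range_baseInclusion.symm ▸ hc⟩

end Quotient

end CoxQuotient

end
theorem mainTheorem3 (k : Type u) [Field k] [IsAlgClosed k]
    (X : Scheme.{u}) [X.Over (Spec (.of k))] [IsIntegral X] [IsProper (X ↘ Spec (.of k))]
    (hPic : CoxQuotient.PicEqCl k X)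
    {r : ℕ} (b : Module.Basis (Fin r) ℤ (CoxQuotient.Pic X))
    (L : Fin r → CoxQuotient.CartierDivisor X) (hL : ∀ i, CoxQuotient.toPic (L i) = b i)
    (hfg : Algebra.FiniteType k (CoxQuotient.Cox k L))
    (A : CoxQuotient.CartierDivisor X) (hA : CoxQuotient.IsAmple k A) :
    ∃ _ : ModObj (CoxQuotient.torus k X) (CoxQuotient.semistableOver k L A),
      IsModHom (CoxQuotient.torus k X) (CoxQuotient.semistableInclusion k L A) ∧
      ∃ π : CoxQuotient.semistableOver k L A ⟶ X.asOver (Spec (.of k)),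
        CoxQuotient.IsGoodGeometricQuotient (CoxQuotient.torus k X) π := by

  let e : CoxQuotient.Pic X ≃+ (Fin r → ℤ) := b.equivFun.toAddEquiv
  have he' : ∀ P, CoxQuotient.toPic (CoxQuotient.multiDivisor L (e P)) = P := fun P => by
    have h : CoxQuotient.toPic (CoxQuotient.multiDivisor L (e P)) = ∑ i, e P i • b i := by
      unfold CoxQuotient.multiDivisor
      simp [hL]
    exact h.trans (b.sum_equivFun P)
  have he : ∀ m, e (CoxQuotient.toPic (CoxQuotient.multiDivisor L m)) = m := fun m => by
    rw [← e.apply_symm_apply m, he']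
  exact ⟨CoxQuotient.semistableAction L A, CoxQuotient.isModHom_semistableInclusion L A,
    CoxQuotient.exists_isGoodGeometricQuotient hA e.toAddMonoidHom he he'⟩
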